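/- Let $n\ge 1$, let $f:[0,1]^n\to[0,\infty)$ be continuous, let $\Gamma=\partial[0,1]^n\setminus(0,1]^n$ and $a_+=\max(a,0)$. Consider the problems $$\text{(P1)}\quad (u_{x_1})_+\cdots(u_{x_n})_+=f \ \text{ in }(0,1]^n,\qquad u=0\ \text{ on }\Gamma,$$ $$\text{(P2)}\quad (v_{x_1})_+\cdots(v_{x_n})_+=v^{n-1}f \ \text{ in }(0,1]^n,\qquad v=0\ \text{ on }\Gamma.$$ Viscosity subsolutions are upper semicontinuous on $[0,1]^n$, are $\le 0$ on $\Gamma$, and satisfy the inequality "$\le$" at each $x\in(0,1]^n$ for the gradient of every $C^1$ function $\varphi$ touching from above, i.e. such that the subsolution minus $\varphi$ has a local maximum at $x$ relative to $(0,1]^n$; supersolutions are defined symmetrically (lower semicontinuous, $\ge 0$ on $\Gamma$, "$\ge$", local minimum); a viscosity solution is both. "Nondecreasing" means nondecreasing in each coordinate, and $0^0=1$ (when $n=1$). For $h>0$ and $\Omega\subset\mathbb{R}^n$ write $\Omega_h=\Omega\cap(h\mathbb{Z})^n$. The maximal solution of the scheme $$\text{(S2)}\quad \prod_{i=1}^n\Big(\frac{v_h(x)-v_h(x-he_i)}{h}\Big)_+=v_h(x)^{n-1}f(x)\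 \text{ for }x\in(0,1]^n_h,\qquad v_h=0\ \text{ on }\Gamma_h,$$ is the function $v_h:[0,1]^n_h\to\mathbb{R}$ that vanishes on $\Gamma_h$ and whose value $v_h(x)$ at each $x\in(0,1]^n_h$ is the largest real number $t$ with $\prod_{i=1}^n\big(\frac{t-v_h(x-he_i)}{h}\big)_+=t^{n-1}f(x)$. Then: 1. (P1) has exactly one nondecreasing viscosity solution $u$ on $[0,1]^n$. 2. The function $v=u^n/n^n$ is a viscosity solution of (P2), and $w\le v$ on $[0,1]^n$ for every nonnegative viscosity subsolution $w$ of (P2). It is called the maximal viscosity solution of (P2). 3. For every $h>0$, (S2) has exactly one maximal solution $v_h$ on $[0,1]^n_h$. 4. $v_h\to v$ uniformly on $[0,1]^n$ as $h\to0$, that is, $\sup_{x\in[0,1]^n_h}|v_h(x)-v(x)|\to 0$ as $h\to 0^+$. 5. This happens although (P2) has no general comparison principle: if $n\ge2$ and $f\not\equiv0$, there are nonnegative nondecreasing viscosity solutions $w_1,w_2$ of (P2) such that $w_1\le w_2$ fails on $[0,1]^n$. -/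

import Mathlib

open Set

/-- The closed unit cube `[0,1]^n`. (Only its topology, order and `C¹` structure are used, so the
choice of norm on `ℝⁿ` is immaterial.) -/
def cube (n : ℕ) : Set (Fin n → ℝ) := {x | ∀ i, 0 ≤ x i ∧ x i ≤ 1}

/-- The half-open unit cube `(0,1]^n`. -/
def halfOpenCube (n : ℕ) : Set (Fin n → ℝ) := {x | ∀ i, 0 < x i ∧ x i ≤ 1}

/-- `Γ = ∂[0,1]^n \ (0,1]^n`. -/
def Gam (n : ℕ) : Set (Fin n → ℝ) := frontier (cube n) \ halfOpenCube n

/-- `Γ` consists of the points of the closed cube with at least one vanishing coordinate. -/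
theorem mem_Gam_iff {n : ℕ} {x : Fin n → ℝ} : x ∈ Gam n ↔ x ∈ cube n ∧ ∃ i, x i = 0 := by
  have hcl : IsClosed (cube n) := by
    have : cube n = ⋂ i, {x : Fin n → ℝ | 0 ≤ x i ∧ x i ≤ 1} := by
      ext y
      simp [cube]
    rw [this]
    exact isClosed_iInter fun i =>
      (isClosed_le continuous_const (continuous_apply i)).inter
        (isClosed_le (continuous_apply i) continuous_const)
  constructor
  · rintro ⟨h1, h2⟩
    have hx : x ∈ cube n := hcl.frontier_subset h1
    refine ⟨hx, ?_⟩
    by_contra! hne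
    exact h2 fun i => ⟨lt_of_le_of_ne (hx i).1 (Ne.symm (hne i)), (hx i).2⟩
  · rintro ⟨hx, i, hi⟩
    refine ⟨?_, fun h => ?_⟩
    · rw [hcl.frontier_eq]
      refine ⟨hx, fun hint => ?_⟩
      have hev : ∀ᶠ y in nhds x, y ∈ cube n := mem_interior_iff_mem_nhds.1 hint
      have hc : Filter.Tendsto (fun t : ℝ => Function.update x i t) (nhds (x i)) (nhds x) := by
        have h : Continuous fun t : ℝ => Function.update x i t :=
          continuous_const.update i continuous_id
        simpa using h.tendsto (x i)
      obtain ⟨ε, hε, hb⟩ := Metric.eventually_nhds_iff.1 (hc.eventually hev)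
      have h3 := (hb (y := -(ε / 2)) (by
        rw [hi, Real.dist_eq, sub_zero, abs_neg, abs_of_pos (by linarith)]; linarith) i).1
      simp only [Function.update_self] at h3
      linarith
    · exact absurd (h i).1 (by rw [hi]; exact lt_irrefl 0)

/-- `x ∈ ℤ_h^n`, the lattice of points all of whose coordinates are integer multiples of `h`. -/
def lattice (n : ℕ) (h : ℝ) : Set (Fin n → ℝ) := {x | ∀ i, ∃ k : ℤ, x i = h * k}

/-- The partial derivative `φ_{x_i}(x)`. -/
noncomputable def partialDeriv {n : ℕ} (φ : (Fin n → ℝ) → ℝ) (i : Fin n) (x : Fin n → ℝ) : ℝ :=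
  fderiv ℝ φ x (Pi.single i 1)

/-- `u` is a viscosity subsolution of the problem `H(x, u, Du) = 0` in `(0,1]^n`, `u = 0` on `Γ`:
`u` is upper semicontinuous on `[0,1]^n`, `u ≤ 0` on `Γ`, and `H(x, u(x), Dφ(x)) ≤ 0` whenever
`φ` is `C¹` and `u - φ` has a local maximum at `x` relative to `(0,1]^n`. -/
def IsViscositySubsolution {n : ℕ} (H : (Fin n → ℝ) → ℝ → (Fin n → ℝ) → ℝ)
    (u : (Fin n → ℝ) → ℝ) : Prop :=
  UpperSemicontinuousOn u (cube n) ∧ (∀ x ∈ Gam n, u x ≤ 0) ∧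
    ∀ x ∈ halfOpenCube n, ∀ φ : (Fin n → ℝ) → ℝ, ContDiff ℝ 1 φ →
      IsLocalMaxOn (fun y => u y - φ y) (halfOpenCube n) x →
        H x (u x) (fun i => partialDeriv φ i x) ≤ 0

/-- `u` is a viscosity supersolution of the problem `H(x, u, Du) = 0` in `(0,1]^n`, `u = 0` on
`Γ`: the inequalities of the subsolution case are reversed, with lower semicontinuity and local
minima. -/
def IsViscositySupersolution {n : ℕ} (H : (Fin n → ℝ) → ℝ → (Fin n → ℝ) → ℝ)
    (u : (Fin n → ℝ) → ℝ) : Prop :=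
  LowerSemicontinuousOn u (cube n) ∧ (∀ x ∈ Gam n, 0 ≤ u x) ∧
    ∀ x ∈ halfOpenCube n, ∀ φ : (Fin n → ℝ) → ℝ, ContDiff ℝ 1 φ →
      IsLocalMinOn (fun y => u y - φ y) (halfOpenCube n) x →
        0 ≤ H x (u x) (fun i => partialDeriv φ i x)

/-- A viscosity solution is a function that is both a sub- and a supersolution; in particular it
is continuous on `[0,1]^n` and vanishes on `Γ`. -/
def IsViscositySolution {n : ℕ} (H : (Fin n → ℝ) → ℝ → (Fin n → ℝ) → ℝ)
    (u : (Fin n → ℝ) → ℝ) : Prop :=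
  IsViscositySubsolution H u ∧ IsViscositySupersolution H u

/-- The Hamiltonian of (P1): `(u_{x_1})_+ ⋯ (u_{x_n})_+ = f`. -/
noncomputable def hamP1 {n : ℕ} (f : (Fin n → ℝ) → ℝ) (x : Fin n → ℝ) (_z : ℝ)
    (p : Fin n → ℝ) : ℝ :=
  (∏ i, max (p i) 0) - f x

/-- The Hamiltonian of (P2): `(v_{x_1})_+ ⋯ (v_{x_n})_+ = v^{n-1} f`. -/
noncomputable def hamP2 {n : ℕ} (f : (Fin n → ℝ) → ℝ) (x : Fin n → ℝ) (z : ℝ)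
    (p : Fin n → ℝ) : ℝ :=
  (∏ i, max (p i) 0) - z ^ (n - 1) * f x

/-- `u` is a nondecreasing (in each coordinate) viscosity solution of (P1) on `[0,1]^n`. -/
def IsNondecreasingSolutionP1 {n : ℕ} (f u : (Fin n → ℝ) → ℝ) : Prop :=
  MonotoneOn u (cube n) ∧ IsViscositySolution (hamP1 f) u

/-- `v` is, on `[0,1]^n`, the maximal viscosity solution `u^n / n^n` of (P2), where `u` is the
nondecreasing viscosity solution of (P1). -/
def IsMaximalSolutionP2 {n : ℕ} (f v : (Fin n → ℝ) → ℝ) : Prop :=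
  ∃ u : (Fin n → ℝ) → ℝ, IsNondecreasingSolutionP1 f u ∧
    ∀ x ∈ cube n, v x = u x ^ n / (n : ℝ) ^ n

/-- `vh` is the maximal solution of the scheme (S2) with mesh size `h`: it vanishes on `Γ_h`, and
at each `x ∈ (0,1]^n_h` the value `vh x` is the largest real number `t` that solves the equation
`∏ i, ((t - vh (x - h e_i)) / h)_+ = t^{n-1} f(x)` of the scheme at `x`.
Only the values of `vh` on `[0,1]^n_h` matter. -/
def IsMaximalSolutionS2 {n : ℕ} (h : ℝ) (f vh : (Fin n → ℝ) → ℝ) : Prop :=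
  (∀ x ∈ Gam n ∩ lattice n h, vh x = 0) ∧
    ∀ x ∈ halfOpenCube n ∩ lattice n h,
      IsGreatest {t : ℝ | ∏ i, max ((t - vh (x - Pi.single i h)) / h) 0 = t ^ (n - 1) * f x} (vh x)

open Filter Topology

/-! The substitution `w = (u/n)^n` multiplies both sides of (P1) by a power of `u/n` and so turns
(P1) into (P2) wherever `u > 0`. It degenerates only where `u = 0`. For subsolutions this is
harmless: a test function touching a nonnegative function from above at a zero has nonpositive
partial derivatives. Supersolutions must be positive wherever `f > 0`. This asymmetry is why (P2)
has a maximal solution but no comparison principle: zero also solves it when `n ≥ 2`.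

For (P1), a subsolution lies below every nondecreasing supersolution (`comparison`). Adding `c ∑ xᵢ`
to such a supersolution raises the right-hand side by at least `c^n`, and with this gap the usual
doubling of variables applies. No condition is needed on the faces `xᵢ = 1`, since the viscosity
inequalities hold up to them.

Existence and convergence are obtained together from the scheme. Taking the largest root at each
grid point makes the grid solution exceed every local discrete subsolution (`le_of_prod_le`); hence
it is nonnegative, nondecreasing, and bounded below by `c ∏ (xᵢ - aᵢ)_+` on a box where `f ≥ c`.
From above it is bounded by `C ∏ xᵢ`. The upper and lower half-relaxed limits are then a sub- and a
supersolution of (P2); the upper barrier gives zero data on Γ, and the lower one makes the lower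
limit positive where `f > 0`. After taking `n`-th roots, comparison for (P1) forces the two limits
to coincide. The common limit is `u^n/n^n`, and compactness makes the convergence uniform. -/

theorem cube_eq_Icc (n : ℕ) : cube n = Set.Icc 0 1 := by
  ext x
  simp [cube, Set.mem_Icc, Pi.le_def, forall_and]

theorem isCompact_cube (n : ℕ) : IsCompact (cube n) := by
  rw [cube_eq_Icc]
  exact isCompact_Icc

theorem halfOpenCube_subset_cube (n : ℕ) : halfOpenCube n ⊆ cube n :=
  fun _ hx i => ⟨(hx i).1.le, (hx i).2⟩

theorem mem_Gam_or_mem_halfOpenCube {n : ℕ} {x : Fin n → ℝ} (hx : x ∈ cube n) :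
    x ∈ Gam n ∨ x ∈ halfOpenCube n := by
  by_cases h : ∃ i, x i = 0
  · exact Or.inl (mem_Gam_iff.2 ⟨hx, h⟩)
  · push Not at h
    exact Or.inr fun i => ⟨lt_of_le_of_ne (hx i).1 (Ne.symm (h i)), (hx i).2⟩

theorem Gam_subset_cube (n : ℕ) : Gam n ⊆ cube n := fun _ hx => (mem_Gam_iff.1 hx).1

theorem eventually_mem_halfOpenCube {n : ℕ} {x : Fin n → ℝ} (hx : x ∈ halfOpenCube n) :
    ∀ᶠ y in 𝓝 x, y ∈ cube n → y ∈ halfOpenCube n := by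
  have h : ∀ᶠ y in 𝓝 x, ∀ i, 0 < y i :=
    eventually_all.2 fun i => (continuous_apply i).continuousAt.eventually (lt_mem_nhds (hx i).1)
  filter_upwards [h] with y hy hc i using ⟨hy i, (hc i).2⟩

/-! ### Difference quotients and derivatives of test functions -/

/-- Base point and step vary together, so plain differentiability is not enough; a `C¹` function is
strictly differentiable. -/
theorem tendsto_backward_difference_quotient {n : ℕ} {ι : Type*} {l : Filter ι}
    {φ : (Fin n → ℝ) → ℝ} (hφ : ContDiff ℝ 1 φ) {x : Fin n → ℝ} {y : ι → Fin n → ℝ} {h : ι → ℝ}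
    (hy : Tendsto y l (𝓝 x)) (hh : Tendsto h l (𝓝[>] 0)) (i : Fin n) :
    Tendsto (fun k => (φ (y k) - φ (y k - Pi.single i (h k))) / h k) l
      (𝓝 (partialDeriv φ i x)) := by
  have hs : HasStrictFDerivAt φ (fderiv ℝ φ x) x :=
    hφ.contDiffAt.hasStrictFDerivAt one_ne_zero
  have hh0 : Tendsto h l (𝓝 0) := hh.mono_right nhdsWithin_le_nhds
  have hpos : ∀ᶠ k in l, 0 < h k := hh.eventually self_mem_nhdsWithin
  have hy' : Tendsto (fun k => y k - Pi.single i (h k)) l (𝓝 x) := by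
    have h1 : Continuous fun t : ℝ => (Pi.single i t : Fin n → ℝ) := continuous_single (A := fun _ : Fin n => ℝ) i
    have := hy.sub ((h1.tendsto 0).comp hh0)
    simpa using this
  have ho := hs.isLittleO.comp_tendsto (hy.prodMk_nhds hy')
  rw [Asymptotics.isLittleO_iff] at ho
  rw [Metric.tendsto_nhds]
  intro ε hε
  filter_upwards [ho (half_pos hε), hpos] with k hk hk0
  have e1 : (Pi.single i (h k) : Fin n → ℝ) = h k • Pi.single i (1 : ℝ) := by
    rw [← Pi.single_smul]; simp
  simp only [Function.comp, sub_sub_cancel, e1, map_smul, norm_smul, smul_eq_mul] at hk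
  rw [Pi.norm_single, norm_one, mul_one, Real.norm_eq_abs, Real.norm_eq_abs, abs_of_pos hk0] at hk
  rw [Real.dist_eq, e1]
  have e2 : (φ (y k) - φ (y k - h k • Pi.single i 1)) / h k - partialDeriv φ i x
      = (φ (y k) - φ (y k - h k • Pi.single i 1) - h k * (fderiv ℝ φ x) (Pi.single i 1)) / h k := by
    rw [partialDeriv]
    field_simp
  rw [e2, abs_div, abs_of_pos hk0, div_lt_iff₀ hk0]
  nlinarith

theorem eventually_sub_single_mem_halfOpenCube {n : ℕ} {x : Fin n → ℝ} (hx : x ∈ halfOpenCube n)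
    (i : Fin n) : ∀ᶠ t in 𝓝[>] (0 : ℝ), x - Pi.single i t ∈ halfOpenCube n := by
  filter_upwards [Ioo_mem_nhdsGT (hx i).1] with t ht j
  rcases eq_or_ne j i with rfl | hj
  · simp only [Pi.sub_apply, Pi.single_eq_same]
    exact ⟨by linarith [ht.2], by linarith [ht.1, (hx j).2]⟩
  · simpa [hj] using hx j

theorem tendsto_sub_single {n : ℕ} (x : Fin n → ℝ) (i : Fin n) :
    Tendsto (fun t : ℝ => x - Pi.single i t) (𝓝[>] 0) (𝓝 x) := by
  have h1 : Continuous fun t : ℝ => x - (Pi.single i t : Fin n → ℝ) :=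
    continuous_const.sub (continuous_single (A := fun _ : Fin n => ℝ) i)
  have := (h1.tendsto 0).mono_left (nhdsWithin_le_nhds (s := Set.Ioi 0))
  simpa using this

/-- Only backward quotients enter, and `x - t eᵢ` remains in the half-open cube for small `t > 0`,
so the sign is available on the faces `xᵢ = 1` as well. -/
theorem partialDeriv_nonneg_of_eventually_le {n : ℕ} {φ : (Fin n → ℝ) → ℝ} (hφ : ContDiff ℝ 1 φ)
    {x : Fin n → ℝ} (hx : x ∈ halfOpenCube n)
    (h : ∀ᶠ y in 𝓝[halfOpenCube n] x, y ≤ x → φ y ≤ φ x) (i : Fin n) :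
    0 ≤ partialDeriv φ i x := by
  have h1 := tendsto_backward_difference_quotient (l := 𝓝[>] (0 : ℝ)) hφ
    (tendsto_const_nhds (x := x)) tendsto_id i
  refine ge_of_tendsto h1 ?_
  have h2 : Tendsto (fun t : ℝ => x - Pi.single i t) (𝓝[>] 0) (𝓝[halfOpenCube n] x) :=
    tendsto_nhdsWithin_iff.2 ⟨tendsto_sub_single x i, eventually_sub_single_mem_halfOpenCube hx i⟩
  filter_upwards [h2.eventually h, self_mem_nhdsWithin] with t ht h0
  have h0 : 0 < t := h0
  refine div_nonneg (sub_nonneg.2 (ht ?_)) h0.le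
  simp [h0.le]

theorem partialDeriv_neg {n : ℕ} (φ : (Fin n → ℝ) → ℝ) (i : Fin n) (x : Fin n → ℝ) :
    partialDeriv (fun y => -φ y) i x = -partialDeriv φ i x := by
  have : (fun y => -φ y) = -φ := rfl
  rw [partialDeriv, this, fderiv_neg]
  rfl

theorem partialDeriv_add {n : ℕ} {φ ψ : (Fin n → ℝ) → ℝ} (hφ : ContDiff ℝ 1 φ)
    (hψ : ContDiff ℝ 1 ψ) (i : Fin n) (x : Fin n → ℝ) :
    partialDeriv (fun y => φ y + ψ y) i x = partialDeriv φ i x + partialDeriv ψ i x := by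
  have : (fun y => φ y + ψ y) = φ + ψ := rfl
  rw [partialDeriv, this, fderiv_add (hφ.differentiable one_ne_zero x)
    (hψ.differentiable one_ne_zero x)]
  rfl

theorem contDiff_coord {n : ℕ} (j : Fin n) : ContDiff ℝ 1 fun y : Fin n → ℝ => y j :=
  contDiff_apply ℝ ℝ j

theorem contDiff_sq_dist {n : ℕ} (c : ℝ) (z : Fin n → ℝ) :
    ContDiff ℝ 1 fun y : Fin n → ℝ => c * ∑ j, (y j - z j) ^ 2 :=
  contDiff_const.mul (ContDiff.sum fun j _ => ((contDiff_coord j).sub contDiff_const).pow 2)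

theorem partialDeriv_sq_dist {n : ℕ} (c : ℝ) (z x : Fin n → ℝ) (i : Fin n) :
    partialDeriv (fun y => c * ∑ j, (y j - z j) ^ 2) i x = 2 * c * (x i - z i) := by
  have h1 : ∀ j : Fin n, HasFDerivAt (fun y : Fin n → ℝ => (y j - z j) ^ 2)
      ((2 * (x j - z j)) • (ContinuousLinearMap.proj j : (Fin n → ℝ) →L[ℝ] ℝ)) x := fun j => by
    have := ((hasFDerivAt_apply (𝕜 := ℝ) j x).sub_const (z j)).pow 2
    simpa using this
  have h2 := (HasFDerivAt.fun_sum fun j (_ : j ∈ Finset.univ) => h1 j).const_mul c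
  rw [partialDeriv, h2.fderiv]
  simp only [smul_apply, sum_apply,
    ContinuousLinearMap.proj_apply, smul_eq_mul, Pi.single_apply, mul_ite, mul_one, mul_zero,
    Finset.sum_ite_eq', Finset.mem_univ, if_true]
  ring

theorem partialDeriv_const_mul_sum {n : ℕ} (c : ℝ) (x : Fin n → ℝ) (i : Fin n) :
    partialDeriv (fun y => c * ∑ j, y j) i x = c := by
  have h2 := (HasFDerivAt.fun_sum fun j (_ : j ∈ Finset.univ) =>
    hasFDerivAt_apply (𝕜 := ℝ) j x).const_mul c
  rw [partialDeriv, h2.fderiv]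
  simp [Pi.single_apply]

theorem contDiff_const_mul_sum {n : ℕ} (c : ℝ) :
    ContDiff ℝ 1 fun y : Fin n → ℝ => c * ∑ j, y j :=
  contDiff_const.mul (ContDiff.sum fun j _ => contDiff_coord j)

theorem partialDeriv_scaled_pow {n m : ℕ} {ψ : (Fin n → ℝ) → ℝ} (hψ : ContDiff ℝ 1 ψ) (b : ℝ)
    (i : Fin n) (x : Fin n → ℝ) :
    partialDeriv (fun y => (ψ y / b) ^ m) i x
      = m * (ψ x / b) ^ (m - 1) * (partialDeriv ψ i x / b) := by
  have h1 := (hψ.differentiable one_ne_zero x).hasFDerivAt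
  have h2 : HasFDerivAt (fun y => (ψ y / b) ^ m)
      ((m * (ψ x / b) ^ (m - 1)) • (b⁻¹ • fderiv ℝ ψ x)) x := by
    have := (h1.const_mul b⁻¹).pow m
    simpa [div_eq_inv_mul] using this
  rw [partialDeriv, h2.fderiv, partialDeriv]
  simp only [smul_apply, smul_eq_mul]
  ring

/-! ### Comparison for (P1) -/

/-- Doubling of variables with penalty `k |x - y|²`. At a maximizer `(X, Y)` both test functions
have gradient `2k (X - Y)`, so the products cancel and leave `c ≤ f X - f Y`, which fails once `X`
and `Y` are close. The signs of `u` and `v` on Γ keep the limit point off Γ. -/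
theorem comparison_of_gap {n : ℕ} {f u v : (Fin n → ℝ) → ℝ} {c : ℝ} (hc : 0 < c)
    (hf : ContinuousOn f (cube n)) (hu : IsViscositySubsolution (hamP1 f) u)
    (hv : IsViscositySupersolution (hamP1 fun x => f x + c) v) :
    ∀ x ∈ cube n, u x ≤ v x := by
  by_contra! hcon
  obtain ⟨x₀, hx₀, hlt⟩ := hcon
  obtain ⟨hu1, hu2, hu3⟩ := hu
  obtain ⟨hv1, hv2, hv3⟩ := hv
  set M := u x₀ - v x₀ with hM
  have hMpos : 0 < M := by linarith
  have hK := isCompact_cube n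
  have hne : (cube n).Nonempty := ⟨x₀, hx₀⟩
  obtain ⟨xu, hxu, hxu'⟩ := hu1.exists_isMaxOn hne hK
  obtain ⟨xv, hxv, hxv'⟩ := hv1.exists_isMinOn hne hK
  have hB : ∀ k : ℕ, ∃ p ∈ cube n ×ˢ cube n,
      IsMaxOn (fun p : (Fin n → ℝ) × (Fin n → ℝ) =>
        u p.1 + -v p.2 + -((k : ℝ) * ∑ i, (p.1 i - p.2 i) ^ 2)) (cube n ×ˢ cube n) p := by
    intro k
    have h1 : UpperSemicontinuousOn (fun p : (Fin n → ℝ) × (Fin n → ℝ) => u p.1)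
        (cube n ×ˢ cube n) := hu1.comp continuousOn_fst fun p hp => hp.1
    have h2 : LowerSemicontinuousOn (fun p : (Fin n → ℝ) × (Fin n → ℝ) => v p.2)
        (cube n ×ˢ cube n) := hv1.comp continuousOn_snd fun p hp => hp.2
    have h2' : UpperSemicontinuousOn (fun p : (Fin n → ℝ) × (Fin n → ℝ) => -v p.2)
        (cube n ×ˢ cube n) := continuous_neg.comp_lowerSemicontinuousOn_antitone h2
          fun a b hab => neg_le_neg hab
    have h3 : Continuous fun p : (Fin n → ℝ) × (Fin n → ℝ) =>
        -((k : ℝ) * ∑ i, (p.1 i - p.2 i) ^ 2) := by fun_prop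
    exact ((h1.add h2').add h3.continuousOn.upperSemicontinuousOn).exists_isMaxOn
      (hne.prod hne) (hK.prod hK)
  choose p hp hpmax using hB
  obtain ⟨⟨a, b⟩, hab, σ, hσ, hlim⟩ := (hK.prod hK).tendsto_subseq hp
  have hσ' := hσ.tendsto_atTop
  have hx : Tendsto (fun k => (p (σ k)).1) atTop (𝓝 a) :=
    (continuous_fst.tendsto _).comp hlim
  have hy : Tendsto (fun k => (p (σ k)).2) atTop (𝓝 b) :=
    (continuous_snd.tendsto _).comp hlim
  have hxc : Tendsto (fun k => (p (σ k)).1) atTop (𝓝[cube n] a) :=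
    tendsto_nhdsWithin_iff.2 ⟨hx, Eventually.of_forall fun k => (hp _).1⟩
  have hyc : Tendsto (fun k => (p (σ k)).2) atTop (𝓝[cube n] b) :=
    tendsto_nhdsWithin_iff.2 ⟨hy, Eventually.of_forall fun k => (hp _).2⟩
  have hmax : ∀ k, M + k * ∑ i, ((p k).1 i - (p k).2 i) ^ 2 ≤ u (p k).1 - v (p k).2 := by
    intro k
    have := hpmax k (show (x₀, x₀) ∈ cube n ×ˢ cube n from ⟨hx₀, hx₀⟩)
    simp only [mem_ofPred_eq, sub_self, ne_eq, OfNat.ofNat_ne_zero, not_false_eq_true, zero_pow,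
      Finset.sum_const_zero, mul_zero] at this
    linarith
  -- the two limit points agree
  have hsum0 : Tendsto (fun k => ∑ i, ((p (σ k)).1 i - (p (σ k)).2 i) ^ 2) atTop (𝓝 0) := by
    have hBk : Tendsto (fun k => (u xu - v xv) / (σ k : ℝ)) atTop (𝓝 0) :=
      (tendsto_const_div_atTop_nhds_zero_nat (u xu - v xv)).comp hσ'
    refine tendsto_of_tendsto_of_tendsto_of_le_of_le' tendsto_const_nhds hBk
      (Eventually.of_forall fun k => Finset.sum_nonneg fun i _ => sq_nonneg _) ?_
    filter_upwards [hσ'.eventually_gt_atTop 0] with k hk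
    have hk' : (0 : ℝ) < σ k := by exact_mod_cast hk
    rw [le_div_iff₀ hk']
    have h1 := hmax (σ k)
    have h2 : u (p (σ k)).1 ≤ u xu := hxu' (hp _).1
    have h3 : v xv ≤ v (p (σ k)).2 := hxv' (hp _).2
    linarith
  have hsumab : Tendsto (fun k => ∑ i, ((p (σ k)).1 i - (p (σ k)).2 i) ^ 2) atTop
      (𝓝 (∑ i, (a i - b i) ^ 2)) := by
    have : Continuous fun q : (Fin n → ℝ) × (Fin n → ℝ) => ∑ i, (q.1 i - q.2 i) ^ 2 := by
      fun_prop
    exact (this.tendsto (a, b)).comp hlim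
  have hab' : a = b := by
    have h0 := tendsto_nhds_unique hsumab hsum0
    rw [Finset.sum_eq_zero_iff_of_nonneg fun i _ => sq_nonneg _] at h0
    funext i
    have := h0 i (Finset.mem_univ i)
    exact sub_eq_zero.1 (pow_eq_zero_iff two_ne_zero |>.1 this)
  subst hab'
  have ha : a ∈ cube n := hab.1
  -- If the gap closed at `a`, semicontinuity would give `u - v < 2M/3` along the sequence, against
  -- the lower bound `M` of `hmax`.
  have hgap : 0 < u a - v a := by
    by_contra! hle
    have e1 := hxc.eventually (hu1 a ha (u a + M / 3) (by linarith))
    have e2 := hyc.eventually (hv1 a ha (v a - M / 3) (by linarith))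
    obtain ⟨k, hk1, hk2⟩ := (e1.and e2).exists
    have h1 := hmax (σ k)
    have h2 : 0 ≤ (σ k : ℝ) * ∑ i, ((p (σ k)).1 i - (p (σ k)).2 i) ^ 2 :=
      mul_nonneg (Nat.cast_nonneg _) (Finset.sum_nonneg fun i _ => sq_nonneg _)
    linarith
  have haΩ : a ∈ halfOpenCube n := by
    rcases mem_Gam_or_mem_halfOpenCube ha with h | h
    · linarith [hu2 a h, hv2 a h]
    · exact h
  have hfx := ((hf a ha).tendsto.comp hxc).sub ((hf a ha).tendsto.comp hyc)
  rw [sub_self] at hfx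
  have hev := eventually_mem_halfOpenCube haΩ
  obtain ⟨k, hkx, hky, hkf⟩ := ((hx.eventually hev).and ((hy.eventually hev).and
    (hfx.eventually (gt_mem_nhds hc)))).exists
  have hX := hkx (hp _).1
  have hY := hky (hp _).2
  set X := (p (σ k)).1
  set Y := (p (σ k)).2
  have hmaxk : ∀ x ∈ cube n, ∀ y ∈ cube n,
      u x + -v y + -((σ k : ℝ) * ∑ i, (x i - y i) ^ 2)
        ≤ u X + -v Y + -((σ k : ℝ) * ∑ i, (X i - Y i) ^ 2) := fun x hx y hy =>
    hpmax (σ k) (show (x, y) ∈ cube n ×ˢ cube n from ⟨hx, hy⟩)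
  have hsub := hu3 X hX _ (contDiff_sq_dist (σ k : ℝ) Y) (by
    filter_upwards [self_mem_nhdsWithin] with x hx
    have := hmaxk x (halfOpenCube_subset_cube n hx) Y (hp _).2
    linarith)
  have hsup := hv3 Y hY _ (contDiff_sq_dist (-(σ k : ℝ)) X) (by
    filter_upwards [self_mem_nhdsWithin] with y hy
    have := hmaxk X (hp _).1 y (halfOpenCube_subset_cube n hy)
    have e : ∀ z w : Fin n → ℝ, ∑ i, (z i - w i) ^ 2 = ∑ i, (w i - z i) ^ 2 := fun z w =>
      Finset.sum_congr rfl fun i _ => by ring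
    rw [e X y, e X Y] at this
    linarith)
  simp only [hamP1, partialDeriv_sq_dist] at hsub hsup
  have e : ∀ i, 2 * -(σ k : ℝ) * (Y i - X i) = 2 * (σ k : ℝ) * (X i - Y i) := fun i => by ring
  simp only [e] at hsup
  simp only [Function.comp] at hkf
  linarith

theorem partialDeriv_nonneg_of_isLocalMinOn {n : ℕ} {v φ : (Fin n → ℝ) → ℝ}
    (hv : MonotoneOn v (cube n)) {x : Fin n → ℝ} (hx : x ∈ halfOpenCube n) (hφ : ContDiff ℝ 1 φ)
    (h : IsLocalMinOn (fun y => v y - φ y) (halfOpenCube n) x) (i : Fin n) :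
    0 ≤ partialDeriv φ i x := by
  refine partialDeriv_nonneg_of_eventually_le hφ hx ?_ i
  filter_upwards [h, self_mem_nhdsWithin] with y hy hyΩ hyx
  have := hv (halfOpenCube_subset_cube n hyΩ) (halfOpenCube_subset_cube n hx) hyx
  linarith

theorem prod_add_pow_le_prod_add {n : ℕ} (hn : 1 ≤ n) {p : Fin n → ℝ} (hp : ∀ i, 0 ≤ p i) {c : ℝ}
    (hc : 0 ≤ c) : ∏ i, p i + c ^ n ≤ ∏ i, (p i + c) := by
  have := Finset.prod_add_prod_le (s := Finset.univ) (i := (⟨0, hn⟩ : Fin n))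
    (f := fun i => p i + c) (g := p) (h := fun _ => c) (Finset.mem_univ _) le_rfl
    (fun j _ _ => by linarith) (fun j _ _ => by linarith [hp j]) (fun j _ => hp j)
    (fun _ _ => hc)
  simpa using this

/-- If `φ` touches the new function from below, `φ - c ∑ xᵢ` touches `v`, and monotonicity makes its
partials `pᵢ` nonnegative. Thus no positive part truncates anything, and `∏ (pᵢ + c) ≥ ∏ pᵢ + c^n`.
-/
theorem supersolution_add_linear {n : ℕ} (hn : 1 ≤ n) {f v : (Fin n → ℝ) → ℝ}
    (hv : IsViscositySupersolution (hamP1 f) v) (hmono : MonotoneOn v (cube n)) {c : ℝ}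
    (hc : 0 < c) :
    IsViscositySupersolution (hamP1 fun x => f x + c ^ n) fun x => v x + c * ∑ i, x i := by
  obtain ⟨hv1, hv2, hv3⟩ := hv
  refine ⟨hv1.add (contDiff_const_mul_sum c).continuous.continuousOn.lowerSemicontinuousOn,
    fun x hx => ?_, fun x hx φ hφ hmin => ?_⟩
  · exact add_nonneg (hv2 x hx)
      (mul_nonneg hc.le (Finset.sum_nonneg fun i _ => (Gam_subset_cube n hx i).1))
  · have hψ : ContDiff ℝ 1 fun y => φ y + -c * ∑ j, y j := hφ.add (contDiff_const_mul_sum (-c))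
    have hmin' : IsLocalMinOn (fun y => v y - (φ y + -c * ∑ j, y j)) (halfOpenCube n) x := by
      filter_upwards [hmin] with y hy
      linarith
    have h1 := partialDeriv_nonneg_of_isLocalMinOn hmono hx hψ hmin'
    have h2 := hv3 x hx _ hψ hmin'
    simp only [hamP1, partialDeriv_add hφ (contDiff_const_mul_sum (-c)),
      partialDeriv_const_mul_sum] at h1 h2 ⊢
    have h3 := prod_add_pow_le_prod_add hn h1 hc.le
    have e1 : ∀ i, max (partialDeriv φ i x + -c) 0 = partialDeriv φ i x + -c := fun i =>
      max_eq_left (h1 i)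
    have e2 : ∀ i, max (partialDeriv φ i x) 0 = partialDeriv φ i x + -c + c := fun i => by
      rw [max_eq_left (by linarith [h1 i])]; ring
    simp only [e1] at h2
    simp only [e2]
    linarith

theorem comparison {n : ℕ} (hn : 1 ≤ n) {f u v : (Fin n → ℝ) → ℝ}
    (hf : ContinuousOn f (cube n)) (hu : IsViscositySubsolution (hamP1 f) u)
    (hv : IsViscositySupersolution (hamP1 f) v) (hmono : MonotoneOn v (cube n)) :
    ∀ x ∈ cube n, u x ≤ v x := by
  intro x hx
  have h1 : ∀ c : ℝ, 0 < c → u x ≤ v x + c * ∑ i, x i := fun c hc =>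
    comparison_of_gap (pow_pos hc n) hf hu (supersolution_add_linear hn hv hmono hc) x hx
  have h2 : Tendsto (fun c : ℝ => v x + c * ∑ i, x i) (𝓝[>] 0) (𝓝 (v x + 0 * ∑ i, x i)) := by
    refine (Continuous.tendsto ?_ 0).mono_left nhdsWithin_le_nhds
    fun_prop
  rw [zero_mul, add_zero] at h2
  exact ge_of_tendsto h2 (by filter_upwards [self_mem_nhdsWithin] with c hc using h1 c hc)

/-! ### The substitution `w = (u/n)^n` -/

/-- Each partial derivative acquires a factor `((φ + k)/n)^(n-1)`; the product of the `n` factors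
equals the factor multiplying `f`. The argument `z` is free because (P1) does not depend on the
unknown. -/
theorem hamP2_scaled_pow {n : ℕ} (hn : 1 ≤ n) (f : (Fin n → ℝ) → ℝ) {φ : (Fin n → ℝ) → ℝ}
    (hφ : ContDiff ℝ 1 φ) (k z : ℝ) {x : Fin n → ℝ} (hx : 0 < φ x + k) :
    hamP2 f x (((φ x + k) / n) ^ n) (fun i => partialDeriv (fun y => ((φ y + k) / n) ^ n) i x)
      = ((φ x + k) / n) ^ ((n - 1) * n) * hamP1 f x z fun i => partialDeriv φ i x := by
  have hnpos : (0 : ℝ) < n := by exact_mod_cast hn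
  have hd : ∀ i, partialDeriv (fun y => ((φ y + k) / n) ^ n) i x
      = ((φ x + k) / n) ^ (n - 1) * partialDeriv φ i x := fun i => by
    rw [partialDeriv_scaled_pow (hφ.add contDiff_const), partialDeriv_add hφ contDiff_const]
    simp only [partialDeriv, fderiv_fun_const, Pi.zero_apply, zero_apply, add_zero]
    field_simp
  have e : ∀ i, max (((φ x + k) / n) ^ (n - 1) * partialDeriv φ i x) 0
      = ((φ x + k) / n) ^ (n - 1) * max (partialDeriv φ i x) 0 := fun i => by
    rw [mul_max_of_nonneg _ _ (by positivity), mul_zero]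
  simp only [hamP1, hamP2, hd, e, Finset.prod_mul_distrib, Finset.prod_const, Finset.card_univ,
    Fintype.card_fin, ← pow_mul, mul_comm n (n - 1), ← mul_sub]

theorem eventually_pos_add_const {n : ℕ} {φ : (Fin n → ℝ) → ℝ} (hφ : ContDiff ℝ 1 φ) {k : ℝ}
    {x : Fin n → ℝ} (hx : 0 < φ x + k) : ∀ᶠ y in 𝓝[halfOpenCube n] x, 0 < φ y + k :=
  ((hφ.continuous.add continuous_const).continuousAt.eventually (lt_mem_nhds hx)).filter_mono
    nhdsWithin_le_nhds

theorem subsolution_of_pow {n : ℕ} (hn : 1 ≤ n) {f u w : (Fin n → ℝ) → ℝ}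
    (hf0 : ∀ x ∈ cube n, 0 ≤ f x) (hw : IsViscositySubsolution (hamP2 f) w)
    (hu0 : ∀ x ∈ cube n, 0 ≤ u x) (hwu : ∀ x ∈ cube n, w x = (u x / n) ^ n)
    (husc : UpperSemicontinuousOn u (cube n)) :
    IsViscositySubsolution (hamP1 f) u := by
  obtain ⟨-, hw2, hw3⟩ := hw
  have hn0 : n ≠ 0 := by omega
  have hnpos : (0 : ℝ) < n := by exact_mod_cast hn
  have hsub := halfOpenCube_subset_cube n
  refine ⟨husc, fun x hx => ?_, fun x hx φ hφ hmax => ?_⟩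
  · by_contra! hpos
    have := hw2 x hx
    rw [hwu x (Gam_subset_cube n hx)] at this
    have : 0 < (u x / n) ^ n := by positivity
    linarith
  · simp only [hamP1]
    rcases (hu0 x (hsub hx)).eq_or_lt with h0 | hpos
    · have h1 : 0 ≤ partialDeriv (fun y => -φ y) ⟨0, hn⟩ x := by
        refine partialDeriv_nonneg_of_eventually_le hφ.neg hx ?_ _
        filter_upwards [hmax, self_mem_nhdsWithin] with y hy hyΩ _
        linarith [hu0 y (hsub hyΩ)]
      rw [partialDeriv_neg] at h1
      rw [Finset.prod_eq_zero (Finset.mem_univ (⟨0, hn⟩ : Fin n)) (max_eq_right (by linarith))]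
      linarith [hf0 x (hsub hx)]
    -- Shifting `φ` by `u x - φ x` makes it touch `u` at `x`, so taking powers preserves the
    -- contact.
    · have hψx : φ x + (u x - φ x) = u x := by ring
      rw [← hψx] at hpos
      have h1 := hw3 x hx (fun y => ((φ y + (u x - φ x)) / n) ^ n)
        (((hφ.add contDiff_const).div_const _).pow n) (by
          filter_upwards [hmax, self_mem_nhdsWithin, eventually_pos_add_const hφ hpos]
            with y hy hyΩ hy0
          rw [hwu y (hsub hyΩ), hwu x (hsub hx), hψx, sub_self, sub_nonpos]
          have hle : u y ≤ φ y + (u x - φ x) := by linarith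
          have := hu0 y (hsub hyΩ)
          gcongr)
      rw [hwu x (hsub hx)] at h1
      nth_rw 1 [← hψx] at h1
      rw [hamP2_scaled_pow hn f hφ _ 0 hpos] at h1
      exact nonpos_of_mul_nonpos_right h1 (by positivity)

/-- Where `f = 0` the inequality is trivial; elsewhere `hpos'` allows division by a power of `u`.
Without it the zero function would be a counterexample for `n ≥ 2`. -/
theorem supersolution_of_pow {n : ℕ} (hn : 1 ≤ n) {f u w : (Fin n → ℝ) → ℝ}
    (hf0 : ∀ x ∈ cube n, 0 ≤ f x) (hw : IsViscositySupersolution (hamP2 f) w)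
    (hu0 : ∀ x ∈ cube n, 0 ≤ u x) (hwu : ∀ x ∈ cube n, w x = (u x / n) ^ n)
    (hpos' : ∀ x ∈ halfOpenCube n, 0 < f x → 0 < u x)
    (hlsc : LowerSemicontinuousOn u (cube n)) :
    IsViscositySupersolution (hamP1 f) u := by
  obtain ⟨-, hw2, hw3⟩ := hw
  have hn0 : n ≠ 0 := by omega
  have hnpos : (0 : ℝ) < n := by exact_mod_cast hn
  have hsub := halfOpenCube_subset_cube n
  refine ⟨hlsc, fun x hx => hu0 x (Gam_subset_cube n hx), fun x hx φ hφ hmin => ?_⟩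
  simp only [hamP1]
  rcases (hf0 x (hsub hx)).eq_or_lt with h0 | hfpos
  · rw [← h0, sub_zero]
    exact Finset.prod_nonneg fun i _ => le_max_right _ _
  · have hpos := hpos' x hx hfpos
    have hψx : φ x + (u x - φ x) = u x := by ring
    rw [← hψx] at hpos
    have h1 := hw3 x hx (fun y => ((φ y + (u x - φ x)) / n) ^ n)
      (((hφ.add contDiff_const).div_const _).pow n) (by
        filter_upwards [hmin, self_mem_nhdsWithin, eventually_pos_add_const hφ hpos]
          with y hy hyΩ hy0
        rw [hwu y (hsub hyΩ), hwu x (hsub hx), hψx, sub_self, sub_nonneg]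
        have hle : φ y + (u x - φ x) ≤ u y := by linarith
        gcongr)
    rw [hwu x (hsub hx)] at h1
    nth_rw 1 [← hψx] at h1
    rw [hamP2_scaled_pow hn f hφ _ 0 hpos] at h1
    exact nonneg_of_mul_nonneg_right h1 (by positivity)

/-! ### The scalar equation at one grid point -/

section RootFinding

variable {n : ℕ} {h c : ℝ} {a : Fin n → ℝ}

theorem exists_forall_gt_pow_mul_lt_prod (hn : 1 ≤ n) (hh : 0 < h) (a : Fin n → ℝ) (c : ℝ) :
    ∃ T, ∀ t, T < t → t ^ (n - 1) * c < ∏ i, max ((t - a i) / h) 0 := by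
  -- The first bound gives `t - aᵢ ≥ t/2` for all `i`; the second makes `(t/(2h))^n` exceed `t^(n-1)
  -- c`.
  refine ⟨max (max (2 * ∑ i, |a i|) ((2 * h) ^ n * c)) 0, fun t ht => ?_⟩
  obtain ⟨ht12, ht0⟩ := max_lt_iff.1 ht
  obtain ⟨ht1, ht2⟩ := max_lt_iff.1 ht12
  have h1 : ∀ i, t / (2 * h) ≤ max ((t - a i) / h) 0 := fun i => by
    have h2 : a i ≤ ∑ j, |a j| := (le_abs_self _).trans
      (Finset.single_le_sum (f := fun j => |a j|) (fun j _ => abs_nonneg _) (Finset.mem_univ i))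
    refine le_trans ?_ (le_max_left _ _)
    rw [div_le_div_iff₀ (by positivity) hh]
    nlinarith
  have h3 : (t / (2 * h)) ^ n ≤ ∏ i, max ((t - a i) / h) 0 := by
    have := Finset.prod_le_prod (s := (Finset.univ : Finset (Fin n))) (f := fun _ => t / (2 * h))
      (fun i _ => by positivity) fun i _ => h1 i
    rwa [Finset.prod_const, Finset.card_univ, Fintype.card_fin] at this
  refine lt_of_lt_of_le ?_ h3
  obtain ⟨m, rfl⟩ : ∃ m, n = m + 1 := ⟨n - 1, by omega⟩
  rw [Nat.add_sub_cancel, div_pow, lt_div_iff₀ (by positivity), pow_succ t]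
  have : 0 < t ^ m := by positivity
  nlinarith

theorem continuous_prod_max (h : ℝ) (a : Fin n → ℝ) :
    Continuous fun t : ℝ => ∏ i, max ((t - a i) / h) 0 :=
  continuous_finsetProd _ fun _ _ =>
    (((continuous_id.sub continuous_const).div_const h).max continuous_const)

theorem exists_root_ge (hn : 1 ≤ n) (hh : 0 < h) {s : ℝ}
    (hs : ∏ i, max ((s - a i) / h) 0 ≤ s ^ (n - 1) * c) :
    ∃ t, s ≤ t ∧ ∏ i, max ((t - a i) / h) 0 = t ^ (n - 1) * c := by
  obtain ⟨T, hT⟩ := exists_forall_gt_pow_mul_lt_prod hn hh a c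
  have hcont : Continuous fun t : ℝ => ∏ i, max ((t - a i) / h) 0 - t ^ (n - 1) * c :=
    (continuous_prod_max h a).sub ((continuous_id.pow _).mul continuous_const)
  set R := max s T + 1
  have hsR : s ≤ R := (le_max_left s T).trans (by simp [R])
  have hTR : T < R := (le_max_right s T).trans_lt (by simp [R])
  obtain ⟨t, ht, ht0⟩ := intermediate_value_Icc hsR hcont.continuousOn
    (show (0 : ℝ) ∈ Set.Icc _ _ from ⟨sub_nonpos.2 hs, (sub_pos.2 (hT R hTR)).le⟩)
  exact ⟨t, ht.1, sub_eq_zero.1 ht0⟩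

theorem exists_isGreatest_root (hn : 1 ≤ n) (hh : 0 < h) (ha : ∀ i, 0 ≤ a i) (hc : 0 ≤ c) :
    ∃ t, 0 ≤ t ∧ IsGreatest {t : ℝ | ∏ i, max ((t - a i) / h) 0 = t ^ (n - 1) * c} t := by
  set S := {t : ℝ | ∏ i, max ((t - a i) / h) 0 = t ^ (n - 1) * c}
  obtain ⟨t₀, ht₀, hroot⟩ := exists_root_ge (a := a) (c := c) (s := 0) hn hh (by
    rw [Finset.prod_eq_zero (Finset.mem_univ (⟨0, hn⟩ : Fin n))]
    · positivity
    · exact max_eq_right (div_nonpos_of_nonpos_of_nonneg (by linarith [ha ⟨0, hn⟩]) hh.le))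
  have hne : S.Nonempty := ⟨t₀, hroot⟩
  have hbdd : BddAbove S := by
    obtain ⟨T, hT⟩ := exists_forall_gt_pow_mul_lt_prod hn hh a c
    refine ⟨T, fun t ht => ?_⟩
    by_contra! hlt
    exact (hT t hlt).ne' ht
  have hclosed : IsClosed S :=
    isClosed_eq (continuous_prod_max h a) ((continuous_id.pow _).mul continuous_const)
  have hgr : IsGreatest S (sSup S) := ⟨hclosed.csSup_mem hne hbdd, fun t ht => le_csSup hbdd ht⟩
  exact ⟨sSup S, ht₀.trans (hgr.2 hroot), hgr⟩

end RootFinding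

/-! ### Induction on the grid -/

section Grid

variable {n : ℕ} {h : ℝ}

theorem sub_single_mem_grid (hh : 0 < h) {x : Fin n → ℝ} (hx : x ∈ halfOpenCube n ∩ lattice n h)
    (i : Fin n) : x - Pi.single i h ∈ cube n ∩ lattice n h := by
  obtain ⟨hx1, hx2⟩ := hx
  constructor
  · intro j
    rcases eq_or_ne j i with rfl | hj
    · obtain ⟨k, hk⟩ := hx2 j
      have h0 := (hx1 j).1
      rw [hk] at h0
      have hk0 : 0 < k := by
        have := pos_of_mul_pos_right h0 hh.le
        exact_mod_cast this
      have hk1 : (1 : ℝ) ≤ k := by exact_mod_cast hk0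
      simp only [Pi.sub_apply, Pi.single_eq_same]
      refine ⟨?_, by linarith [(hx1 j).2]⟩
      rw [hk]
      nlinarith
    · simpa [hj] using halfOpenCube_subset_cube n hx1 j
  · intro j
    obtain ⟨k, hk⟩ := hx2 j
    rcases eq_or_ne j i with rfl | hj
    · exact ⟨k - 1, by simp [hk]; ring⟩
    · exact ⟨k, by simp [hj, hk]⟩

theorem sum_sub_single (x : Fin n → ℝ) (i : Fin n) (h : ℝ) :
    ∑ j, (x - Pi.single i h : Fin n → ℝ) j = ∑ j, x j - h := by
  simp [Finset.sum_sub_distrib]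

/-- A backward step lowers the coordinate sum by `h`, and this sum is nonnegative on the cube. -/
theorem grid_induction (hh : 0 < h) {P : (Fin n → ℝ) → Prop}
    (h0 : ∀ x ∈ Gam n ∩ lattice n h, P x)
    (hstep : ∀ x ∈ halfOpenCube n ∩ lattice n h, (∀ i, P (x - Pi.single i h)) → P x) :
    ∀ x ∈ cube n ∩ lattice n h, P x := by
  have key : ∀ N : ℕ, ∀ x ∈ cube n ∩ lattice n h, ∑ i, x i < N * h → P x := by
    intro N
    induction N with
    | zero =>
      intro x hx hs
      have := Finset.sum_nonneg fun i (_ : i ∈ Finset.univ) => (hx.1 i).1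
      simp only [Nat.cast_zero, zero_mul] at hs
      linarith
    | succ N ih =>
      intro x hx hs
      rcases mem_Gam_or_mem_halfOpenCube hx.1 with hg | hg
      · exact h0 x ⟨hg, hx.2⟩
      · refine hstep x ⟨hg, hx.2⟩ fun i => ih _ (sub_single_mem_grid hh ⟨hg, hx.2⟩ i) ?_
        rw [sum_sub_single]
        push_cast at hs
        linarith
  intro x hx
  obtain ⟨N, hN⟩ := exists_nat_gt ((∑ i, x i) / h)
  exact key N x hx ((div_lt_iff₀ hh).1 hN)

end Grid

/-! ### The maximal grid solution: existence, monotonicity, barriers -/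

section Scheme

variable {n : ℕ} {h : ℝ} {f V : (Fin n → ℝ) → ℝ}

theorem exists_isMaximalSolutionS2 (hn : 1 ≤ n) (hh : 0 < h) (hf0 : ∀ x ∈ cube n, 0 ≤ f x) :
    ∃ V, IsMaximalSolutionS2 h f V := by
  classical
  -- The scheme is solved layer by layer in the coordinate sum. Nonnegativity is carried along
  -- because the largest root is only known to exist for nonnegative neighbour values.
  have key : ∀ N : ℕ, ∃ V : (Fin n → ℝ) → ℝ, (∀ x, 0 ≤ V x) ∧ (∀ x ∈ Gam n, V x = 0) ∧
      ∀ x ∈ halfOpenCube n ∩ lattice n h, ∑ i, x i < N * h →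
        IsGreatest {t : ℝ | ∏ i, max ((t - V (x - Pi.single i h)) / h) 0
          = t ^ (n - 1) * f x} (V x) := by
    intro N
    induction N with
    | zero =>
      refine ⟨0, fun x => le_rfl, fun x _ => rfl, fun x hx hs => ?_⟩
      have := Finset.sum_nonneg fun i (_ : i ∈ Finset.univ) => (hx.1 i).1.le
      simp only [Nat.cast_zero, zero_mul] at hs
      linarith
    | succ N ih =>
      obtain ⟨V, hV0, hVΓ, hV⟩ := ih
      have hroot : ∀ x, ∃ t, 0 ≤ t ∧ (x ∈ halfOpenCube n →
          IsGreatest {t : ℝ | ∏ i, max ((t - V (x - Pi.single i h)) / h) 0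
            = t ^ (n - 1) * f x} t) := fun x => by
        by_cases hx : x ∈ halfOpenCube n
        · obtain ⟨t, ht0, ht⟩ := exists_isGreatest_root (c := f x) hn hh
            (fun i => hV0 (x - Pi.single i h)) (hf0 x (halfOpenCube_subset_cube n hx))
          exact ⟨t, ht0, fun _ => ht⟩
        · exact ⟨0, le_rfl, fun h => absurd h hx⟩
      choose G hG0 hG using hroot
      refine ⟨fun x => if ∑ i, x i < N * h ∨ x ∈ Gam n then V x else G x, fun x => ?_,
        fun x hx => ?_, fun x hx hs => ?_⟩
      · dsimp only
        split_ifs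
        exacts [hV0 x, hG0 x]
      · simp [hx, hVΓ x hx]
      · have hnb : ∀ i, ∑ j, (x - Pi.single i h : Fin n → ℝ) j < N * h := fun i => by
          rw [sum_sub_single]
          push_cast at hs
          linarith
        simp only [hnb, true_or, if_true]
        have hxΓ : x ∉ Gam n := fun hg => by
          obtain ⟨-, i, hi⟩ := mem_Gam_iff.1 hg
          exact (hx.1 i).1.ne' hi
        by_cases hN : ∑ i, x i < N * h
        · simpa only [hN, true_or, if_true] using hV x hx hN
        · simpa only [hN, hxΓ, or_self, if_false] using hG x hx.1
  obtain ⟨N, hN⟩ := exists_nat_gt (n / h : ℝ)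
  rw [div_lt_iff₀ hh] at hN
  obtain ⟨V, -, hVΓ, hV⟩ := key N
  refine ⟨V, fun x hx => hVΓ x hx.1, fun x hx => hV x hx (lt_of_le_of_lt ?_ hN)⟩
  have := Finset.sum_le_sum fun i (_ : i ∈ Finset.univ) => (hx.1 i).2
  simpa using this

namespace IsMaximalSolutionS2

theorem eqOn (hh : 0 < h) {V' : (Fin n → ℝ) → ℝ} (hV : IsMaximalSolutionS2 h f V)
    (hV' : IsMaximalSolutionS2 h f V') : Set.EqOn V' V (cube n ∩ lattice n h) := by
  refine grid_induction hh (fun x hx => by rw [hV.1 x hx, hV'.1 x hx]) fun x hx ih => ?_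
  have h1 := hV'.2 x hx
  simp only [ih] at h1
  exact h1.unique (hV.2 x hx)

/-- The form in which maximality is used: for large `t` the product dominates, so a root lies at or
above `s`. Bounds from below thus only need a discrete subsolution inequality at a single point. -/
theorem le_of_prod_le (hn : 1 ≤ n) (hh : 0 < h) (hV : IsMaximalSolutionS2 h f V)
    {x : Fin n → ℝ} (hx : x ∈ halfOpenCube n ∩ lattice n h) {s : ℝ}
    (hs : ∏ i, max ((s - V (x - Pi.single i h)) / h) 0 ≤ s ^ (n - 1) * f x) : s ≤ V x := by
  obtain ⟨t, hst, ht⟩ := exists_root_ge hn hh hs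
  exact hst.trans ((hV.2 x hx).2 ht)

theorem nonneg (hn : 1 ≤ n) (hh : 0 < h) (hf0 : ∀ x ∈ cube n, 0 ≤ f x)
    (hV : IsMaximalSolutionS2 h f V) : ∀ x ∈ cube n ∩ lattice n h, 0 ≤ V x := by
  refine grid_induction hh (fun x hx => (hV.1 x hx).ge) fun x hx ih => ?_
  refine hV.le_of_prod_le hn hh hx ?_
  rw [Finset.prod_eq_zero (Finset.mem_univ (⟨0, hn⟩ : Fin n))]
  · have := hf0 x (halfOpenCube_subset_cube n hx.1)
    positivity
  · exact max_eq_right (div_nonpos_of_nonpos_of_nonneg (by linarith [ih ⟨0, hn⟩]) hh.le)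

theorem sub_single_le (hn : 1 ≤ n) (hh : 0 < h) (hf0 : ∀ x ∈ cube n, 0 ≤ f x)
    (hV : IsMaximalSolutionS2 h f V) {x : Fin n → ℝ} (hx : x ∈ halfOpenCube n ∩ lattice n h)
    (i : Fin n) : V (x - Pi.single i h) ≤ V x := by
  -- For `s = V (x - h eᵢ)` the `i`-th factor vanishes.
  refine hV.le_of_prod_le hn hh hx ?_
  rw [Finset.prod_eq_zero (Finset.mem_univ i) (by simp)]
  have h1 := hf0 x (halfOpenCube_subset_cube n hx.1)
  have h2 := hV.nonneg hn hh hf0 _ (sub_single_mem_grid hh hx i)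
  positivity

theorem monotoneOn (hn : 1 ≤ n) (hh : 0 < h) (hf0 : ∀ x ∈ cube n, 0 ≤ f x)
    (hV : IsMaximalSolutionS2 h f V) : MonotoneOn V (cube n ∩ lattice n h) := by
  suffices H : ∀ y ∈ cube n ∩ lattice n h, ∀ x ∈ cube n ∩ lattice n h, x ≤ y → V x ≤ V y from
    fun x hx y hy hxy => H y hy x hx hxy
  refine grid_induction hh (fun y hy x hx hxy => ?_) fun y hy ih x hx hxy => ?_
  · obtain ⟨hyc, i, hi⟩ := mem_Gam_iff.1 hy.1
    have : x ∈ Gam n := mem_Gam_iff.2 ⟨hx.1, i, le_antisymm (hi ▸ hxy i) (hx.1 i).1⟩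
    rw [hV.1 x ⟨this, hx.2⟩, hV.1 y hy]
  · rcases eq_or_ne x y with rfl | hne
    · exact le_rfl
    obtain ⟨i, hi⟩ : ∃ i, x i ≠ y i := Function.ne_iff.1 hne
    -- Distinct lattice coordinates differ by at least `h`, so `x ≤ y - h eᵢ`.
    refine (ih i x hx fun j => ?_).trans (hV.sub_single_le hn hh hf0 hy i)
    rcases eq_or_ne j i with rfl | hj
    · obtain ⟨k, hk⟩ := hx.2 j
      obtain ⟨l, hl⟩ := hy.2 j
      have hlt := lt_of_le_of_ne (hxy j) hi
      rw [hk, hl] at hlt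
      have hkl : k < l := by
        have : (k : ℝ) < l := lt_of_mul_lt_mul_left hlt hh.le
        exact_mod_cast this
      have hkl' : (k : ℝ) + 1 ≤ l := by exact_mod_cast hkl
      simp only [Pi.sub_apply, Pi.single_eq_same, hk, hl]
      nlinarith
    · simpa [hj] using hxy j

/-- `C ∏ xᵢ` is linear in each variable, so its backward quotients are exactly its value divided by
`xᵢ`. A value `t` above it has quotients at least `t / xᵢ`, whence `t^n / ∏ xᵢ ≤ t^(n-1) f x` and `t
≤ C ∏ xᵢ`. -/
theorem le_mul_prod (hn : 1 ≤ n) (hh : 0 < h) (hV : IsMaximalSolutionS2 h f V) {C : ℝ}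
    (hC : 0 < C) (hfC : ∀ x ∈ cube n, f x ≤ C) :
    ∀ x ∈ cube n ∩ lattice n h, V x ≤ C * ∏ i, x i := by
  refine grid_induction hh (fun x hx => ?_) fun x hx ih => ?_
  · rw [hV.1 x hx]
    exact mul_nonneg hC.le (Finset.prod_nonneg fun i _ => (Gam_subset_cube n hx.1 i).1)
  · have hxpos : ∀ i, 0 < x i := fun i => (hx.1 i).1
    have hP : 0 < ∏ i, x i := Finset.prod_pos fun i _ => hxpos i
    by_contra! hlt
    set t := V x
    have ht : 0 < t := (mul_pos hC hP).trans hlt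
    have hroot : ∏ i, max ((t - V (x - Pi.single i h)) / h) 0 = t ^ (n - 1) * f x :=
      (hV.2 x hx).1
    have hfac : ∀ i, t / x i ≤ max ((t - V (x - Pi.single i h)) / h) 0 := fun i => by
      have hprod : ∏ j, (x - Pi.single i h : Fin n → ℝ) j = (∏ j, x j) * ((x i - h) / x i) := by
        rw [← Finset.mul_prod_erase _ _ (Finset.mem_univ i),
          ← Finset.mul_prod_erase _ x (Finset.mem_univ i)]
        have : ∏ j ∈ Finset.univ.erase i, (x - Pi.single i h : Fin n → ℝ) j
            = ∏ j ∈ Finset.univ.erase i, x j :=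
          Finset.prod_congr rfl fun j hj => by simp [Finset.ne_of_mem_erase hj]
        rw [this]
        have := (hxpos i).ne'
        simp only [Pi.sub_apply, Pi.single_eq_same]
        field_simp
      have h1 := ih i
      rw [hprod, ← mul_assoc] at h1
      have h2 : 0 ≤ x i - h := by
        simpa using ((sub_single_mem_grid hh hx i).1 i).1
      have h3 : 0 ≤ (x i - h) / x i := div_nonneg h2 (hxpos i).le
      have h4 : V (x - Pi.single i h) ≤ t * ((x i - h) / x i) :=
        h1.trans (mul_le_mul_of_nonneg_right hlt.le h3)
      refine le_trans ?_ (le_max_left _ _)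
      rw [le_div_iff₀ hh]
      have h5 : t / x i * h = t - t * ((x i - h) / x i) := by
        have := (hxpos i).ne'
        field_simp
        ring
      linarith
    have h6 : ∏ i, t / x i ≤ t ^ (n - 1) * f x := by
      rw [← hroot]
      exact Finset.prod_le_prod (fun i _ => (div_pos ht (hxpos i)).le) fun i _ => hfac i
    rw [Finset.prod_div_distrib, Finset.prod_const, Finset.card_univ, Fintype.card_fin,
      div_le_iff₀ hP] at h6
    have h7 : t ^ n = t ^ (n - 1) * t := by rw [← pow_succ, Nat.sub_add_cancel hn]
    rw [h7, mul_assoc] at h6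
    have h8 := le_of_mul_le_mul_left h6 (by positivity)
    have h9 := mul_le_mul_of_nonneg_right (hfC x (halfOpenCube_subset_cube n hx.1)) hP.le
    linarith

/-- The same product, centred at the corner `a` and truncated, is a discrete subsolution in a box
where `f ≥ c`. This rules out convergence to smaller solutions of (P2) such as zero. -/
theorem mul_prod_le (hn : 1 ≤ n) (hh : 0 < h) (hf0 : ∀ x ∈ cube n, 0 ≤ f x)
    (hV : IsMaximalSolutionS2 h f V) {c : ℝ} (hc : 0 ≤ c) {a b : Fin n → ℝ} (ha : ∀ i, 0 ≤ a i)
    (hfc : ∀ x ∈ cube n, a ≤ x → x ≤ b → c ≤ f x) :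
    ∀ x ∈ cube n ∩ lattice n h, x ≤ b → c * ∏ i, max (x i - a i) 0 ≤ V x := by
  have hdeg : ∀ x ∈ cube n ∩ lattice n h, (∃ i, x i ≤ a i) →
      c * ∏ i, max (x i - a i) 0 ≤ V x := by
    rintro x hx ⟨i, hi⟩
    rw [Finset.prod_eq_zero (Finset.mem_univ i) (max_eq_right (by linarith)), mul_zero]
    exact hV.nonneg hn hh hf0 x hx
  refine grid_induction hh (fun x hx _ => ?_) fun x hx ih hxb => ?_
  · obtain ⟨hxc, i, hi⟩ := mem_Gam_iff.1 hx.1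
    exact hdeg x ⟨hxc, hx.2⟩ ⟨i, hi ▸ ha i⟩
  · have hxc := halfOpenCube_subset_cube n hx.1
    by_cases hex : ∃ i, x i ≤ a i
    · exact hdeg x ⟨hxc, hx.2⟩ hex
    push Not at hex
    have hpos : ∀ i, 0 < x i - a i := fun i => sub_pos.2 (hex i)
    have hP : 0 < ∏ i, (x i - a i) := Finset.prod_pos fun i _ => hpos i
    have e0 : ∏ i, max (x i - a i) 0 = ∏ i, (x i - a i) :=
      Finset.prod_congr rfl fun i _ => max_eq_left (hpos i).le
    rw [e0]
    set s := c * ∏ i, (x i - a i) with hs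
    have hs0 : 0 ≤ s := mul_nonneg hc hP.le
    refine hV.le_of_prod_le hn hh hx ?_
    have hfac : ∀ i, max ((s - V (x - Pi.single i h)) / h) 0 ≤ s / (x i - a i) := fun i => by
      refine max_le ?_ (div_nonneg hs0 (hpos i).le)
      have h1 := ih i fun j => by
        refine le_trans ?_ (hxb j)
        rcases eq_or_ne j i with rfl | hj
        · simp [hh.le]
        · simp [hj]
      have hE : s = c * (∏ j ∈ Finset.univ.erase i, (x j - a j)) * (x i - a i) := by
        rw [hs, ← Finset.mul_prod_erase _ _ (Finset.mem_univ i)]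
        ring
      have hE' : ∏ j, max ((x - Pi.single i h : Fin n → ℝ) j - a j) 0
          = max (x i - h - a i) 0 * ∏ j ∈ Finset.univ.erase i, (x j - a j) := by
        rw [← Finset.mul_prod_erase _ _ (Finset.mem_univ i)]
        congr 1
        · simp
        · refine Finset.prod_congr rfl fun j hj => ?_
          simp [Finset.ne_of_mem_erase hj, (hpos j).le]
      have hQ : 0 ≤ c * ∏ j ∈ Finset.univ.erase i, (x j - a j) :=
        mul_nonneg hc (Finset.prod_nonneg fun j _ => (hpos j).le)
      rw [hE'] at h1
      rw [div_le_div_iff₀ hh (hpos i), hE]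
      set Q := c * ∏ j ∈ Finset.univ.erase i, (x j - a j)
      -- If the step leaves the box the left side is negative, and the truncated barrier still
      -- dominates it.
      have h2 : Q * (x i - h - a i) ≤ V (x - Pi.single i h) := by
        refine le_trans (mul_le_mul_of_nonneg_left (le_max_left _ 0) hQ) (le_trans (le_of_eq ?_) h1)
        simp only [Q]
        ring
      nlinarith [hpos i]
    have h6 : ∏ i, max ((s - V (x - Pi.single i h)) / h) 0 ≤ ∏ i, s / (x i - a i) :=
      Finset.prod_le_prod (fun i _ => le_max_right _ _) fun i _ => hfac i
    refine h6.trans ?_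
    rw [Finset.prod_div_distrib, Finset.prod_const, Finset.card_univ, Fintype.card_fin,
      div_le_iff₀ hP]
    have h7 : s ^ n = s ^ (n - 1) * s := by rw [← pow_succ, Nat.sub_add_cancel hn]
    rw [h7, mul_assoc]
    refine mul_le_mul_of_nonneg_left ?_ (by positivity)
    exact mul_le_mul_of_nonneg_right (hfc x hxc (fun i => (hex i).le) hxb) hP.le

end IsMaximalSolutionS2

end Scheme

/-! ### Limits along refining grids -/

/-- The filter of pairs `(h, y)` with `h → 0⁺` and `y → x` along the grid of mesh size `h`. -/
def gridNhds {n : ℕ} (x : Fin n → ℝ) : Filter (ℝ × (Fin n → ℝ)) :=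
  𝓝 (0, x) ⊓ 𝓟 {p | 0 < p.1 ∧ p.2 ∈ cube n ∩ lattice n p.1}

section GridNhds

variable {n : ℕ}

theorem eventually_gridNhds {x : Fin n → ℝ} {P : ℝ × (Fin n → ℝ) → Prop} :
    (∀ᶠ p in gridNhds x, P p) ↔
      ∀ᶠ p in 𝓝 ((0 : ℝ), x), 0 < p.1 ∧ p.2 ∈ cube n ∩ lattice n p.1 → P p :=
  eventually_inf_principal

theorem eventually_mem_gridNhds (x : Fin n → ℝ) :
    ∀ᶠ p in gridNhds x, 0 < p.1 ∧ p.2 ∈ cube n ∩ lattice n p.1 :=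
  eventually_gridNhds.2 (Eventually.of_forall fun _ h => h)

theorem tendsto_gridNhds_iff {x : Fin n → ℝ} {ι : Type*} {l : Filter ι}
    {h : ι → ℝ} {y : ι → Fin n → ℝ} :
    Tendsto (fun k => (h k, y k)) l (gridNhds x) ↔
      Tendsto h l (𝓝 0) ∧ Tendsto y l (𝓝 x) ∧
        ∀ᶠ k in l, 0 < h k ∧ y k ∈ cube n ∩ lattice n (h k) := by
  rw [gridNhds, tendsto_inf, tendsto_principal, nhds_prod_eq, tendsto_prod_iff', and_assoc]
  rfl

theorem tendsto_fst_gridNhds (x : Fin n → ℝ) : Tendsto Prod.fst (gridNhds x) (𝓝[>] 0) :=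
  tendsto_nhdsWithin_iff.2 ⟨(continuous_fst.tendsto ((0 : ℝ), x)).mono_left inf_le_left,
    (eventually_mem_gridNhds x).mono fun _ h => h.1⟩

theorem tendsto_snd_gridNhds (x : Fin n → ℝ) : Tendsto Prod.snd (gridNhds x) (𝓝 x) :=
  (continuous_snd.tendsto ((0 : ℝ), x)).mono_left inf_le_left

theorem eventually_eventually_gridNhds {x : Fin n → ℝ} {P : ℝ × (Fin n → ℝ) → Prop}
    (h : ∀ᶠ p in gridNhds x, P p) : ∀ᶠ y in 𝓝 x, ∀ᶠ p in gridNhds y, P p := by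
  rw [eventually_gridNhds] at h
  have h1 := eventually_eventually_nhds.2 h
  have h2 : Tendsto (fun y : Fin n → ℝ => ((0 : ℝ), y)) (𝓝 x) (𝓝 (0, x)) :=
    (Continuous.prodMk_right (0 : ℝ)).tendsto x
  filter_upwards [h2.eventually h1] with y hy using eventually_gridNhds.2 hy

/-- The largest point of the lattice of mesh size `h` below `x`. -/
noncomputable def gridFloor (x : Fin n → ℝ) (h : ℝ) : Fin n → ℝ := fun i => h * ⌊x i / h⌋

theorem gridFloor_mem {x : Fin n → ℝ} (hx : x ∈ cube n) {h : ℝ} (hh : 0 < h) :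
    gridFloor x h ∈ cube n ∩ lattice n h := by
  refine ⟨fun i => ⟨?_, ?_⟩, fun i => ⟨_, rfl⟩⟩
  · have : 0 ≤ ⌊x i / h⌋ := Int.floor_nonneg.2 (div_nonneg (hx i).1 hh.le)
    exact mul_nonneg hh.le (by exact_mod_cast this)
  · have := mul_le_mul_of_nonneg_left (Int.floor_le (x i / h)) hh.le
    rw [mul_div_cancel₀ _ hh.ne'] at this
    exact this.trans (hx i).2

theorem tendsto_gridFloor (x : Fin n → ℝ) : Tendsto (gridFloor x) (𝓝[>] 0) (𝓝 x) := by
  refine tendsto_pi_nhds.2 fun i => ?_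
  have h1 : Tendsto (fun h : ℝ => x i - h) (𝓝[>] 0) (𝓝 (x i)) := by
    have : Continuous fun h : ℝ => x i - h := continuous_const.sub continuous_id
    simpa using (this.tendsto 0).mono_left (nhdsWithin_le_nhds (s := Set.Ioi 0))
  refine tendsto_of_tendsto_of_tendsto_of_le_of_le' h1 tendsto_const_nhds ?_ ?_
  · filter_upwards [self_mem_nhdsWithin] with h hh
    have hh : 0 < h := hh
    have := mul_le_mul_of_nonneg_left (Int.sub_one_lt_floor (x i / h)).le hh.le
    rw [mul_sub, mul_div_cancel₀ _ hh.ne', mul_one] at this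
    exact this
  · filter_upwards [self_mem_nhdsWithin] with h hh
    have hh : 0 < h := hh
    have := mul_le_mul_of_nonneg_left (Int.floor_le (x i / h)) hh.le
    rwa [mul_div_cancel₀ _ hh.ne'] at this

theorem gridNhds_neBot {x : Fin n → ℝ} (hx : x ∈ cube n) : (gridNhds x).NeBot := by
  have : Tendsto (fun h : ℝ => (h, gridFloor x h)) (𝓝[>] 0) (gridNhds x) :=
    tendsto_gridNhds_iff.2 ⟨nhdsWithin_le_nhds, tendsto_gridFloor x, by
      filter_upwards [self_mem_nhdsWithin] with h hh using ⟨hh, gridFloor_mem hx hh⟩⟩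
  exact this.neBot

theorem inf_mem_grid {h : ℝ} {x y : Fin n → ℝ} (hx : x ∈ cube n ∩ lattice n h)
    (hy : y ∈ cube n ∩ lattice n h) : x ⊓ y ∈ cube n ∩ lattice n h := by
  refine ⟨fun i => ?_, fun i => ?_⟩ <;> rcases le_total (x i) (y i) with hi | hi
  · simpa [hi] using hx.1 i
  · simpa [hi] using hy.1 i
  · simpa [hi] using hx.2 i
  · simpa [hi] using hy.2 i

/-- Transfers monotonicity to the limit: a grid point near `y ≥ x` is pushed down to a grid point
below it that is near `x`. -/
theorem tendsto_inf_gridFloor {x y : Fin n → ℝ} (hx : x ∈ cube n) (hxy : x ≤ y) :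
    Tendsto (fun p : ℝ × (Fin n → ℝ) => (p.1, p.2 ⊓ gridFloor x p.1)) (gridNhds y)
      (gridNhds x) := by
  refine tendsto_gridNhds_iff.2 ⟨(tendsto_fst_gridNhds y).mono_right nhdsWithin_le_nhds, ?_, ?_⟩
  · refine tendsto_pi_nhds.2 fun i => ?_
    have h1 := tendsto_pi_nhds.1 (tendsto_snd_gridNhds y) i
    have h2 := tendsto_pi_nhds.1 ((tendsto_gridFloor x).comp (tendsto_fst_gridNhds y)) i
    have := h1.min h2
    rwa [min_eq_right (hxy i)] at this
  · filter_upwards [eventually_mem_gridNhds y] with p hp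
    exact ⟨hp.1, inf_mem_grid hp.2 (gridFloor_mem hx hp.1)⟩

theorem finite_grid {h : ℝ} (hh : 0 < h) : (cube n ∩ lattice n h).Finite := by
  have hfin : (Set.pi Set.univ fun _ : Fin n => Set.Icc (0 : ℤ) ⌊1 / h⌋).Finite :=
    Set.Finite.pi fun _ => Set.finite_Icc _ _
  refine (hfin.image fun k i => h * (k i : ℝ)).subset fun x hx => ?_
  choose k hk using hx.2
  refine ⟨k, fun i _ => ⟨?_, ?_⟩, funext fun i => (hk i).symm⟩
  · have h0 := (hx.1 i).1
    rw [hk i] at h0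
    have := nonneg_of_mul_nonneg_right h0 hh
    exact_mod_cast this
  · have h1 := (hx.1 i).2
    rw [hk i] at h1
    rw [Int.le_floor, le_div_iff₀ hh]
    linarith

end GridNhds

/-! ### From touching points of the limit to touching points on the grid -/

section Touching

variable {n : ℕ} {V : ℝ → (Fin n → ℝ) → ℝ} {U φ : (Fin n → ℝ) → ℝ} {x : Fin n → ℝ}

/-- Maximize `V h - φ` over the finite grid in a ball around `x`, along meshes where `V` nearly
attains `U x`. A limit point `y₀` of the maximizers satisfies `U x - φ x ≤ U y₀ - φ y₀`, so
strictness forces `y₀ = x`. Stating the hypotheses on `U` abstractly lets the negated family cover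
minima. -/
theorem exists_seq_of_strict_max (hx : x ∈ cube n)
    (hup : ∀ y ∈ cube n, ∀ c, U y < c → ∀ᶠ p in gridNhds y, V p.1 p.2 < c)
    (hfreq : ∀ c, c < U x → ∃ᶠ p in gridNhds x, c < V p.1 p.2)
    (hφ : Continuous φ) {r : ℝ} (hr : 0 < r)
    (hmax : ∀ y ∈ cube n, dist y x ≤ r → y ≠ x → U y - φ y < U x - φ x) :
    ∃ (h : ℕ → ℝ) (y : ℕ → Fin n → ℝ),
      Tendsto (fun k => (h k, y k)) atTop (gridNhds x) ∧
      Tendsto (fun k => V (h k) (y k)) atTop (𝓝 (U x)) ∧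
      ∀ k, 0 < h k ∧ y k ∈ cube n ∩ lattice n (h k) ∧
        ∀ z ∈ cube n ∩ lattice n (h k), dist z x ≤ r →
          V (h k) z - φ z ≤ V (h k) (y k) - φ (y k) := by
  have h1 : ∀ k : ℕ, ∃ p : ℝ × (Fin n → ℝ), U x - 1 / (k + 1) < V p.1 p.2 ∧
      (0 < p.1 ∧ p.2 ∈ cube n ∩ lattice n p.1) ∧ p.1 < 1 / (k + 1) ∧
        dist p.2 x < min r (1 / (k + 1)) := by
    intro k
    have hk : (0 : ℝ) < 1 / (k + 1) := by positivity
    have e1 := (tendsto_fst_gridNhds x).eventually (Ioo_mem_nhdsGT hk)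
    have e2 := (tendsto_snd_gridNhds x).eventually (Metric.ball_mem_nhds x (lt_min hr hk))
    obtain ⟨p, hp1, hp2, hp3, hp4⟩ := ((hfreq (U x - 1 / (k + 1)) (by linarith)).and_eventually
      ((eventually_mem_gridNhds x).and (e1.and e2))).exists
    exact ⟨p, hp1, hp2, hp3.2, hp4⟩
  choose p hpV hpg hph hpd using h1
  have h2 : ∀ k, ∃ y, (y ∈ cube n ∩ lattice n (p k).1 ∧ dist y x ≤ r) ∧
      ∀ z, z ∈ cube n ∩ lattice n (p k).1 ∧ dist z x ≤ r →
        V (p k).1 z - φ z ≤ V (p k).1 y - φ y := fun k => by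
    have hfin : {y | y ∈ cube n ∩ lattice n (p k).1 ∧ dist y x ≤ r}.Finite :=
      (finite_grid (hpg k).1).subset fun y hy => hy.1
    obtain ⟨y, hy, hy'⟩ := hfin.exists_maximalFor (fun y => V (p k).1 y - φ y) _
      ⟨(p k).2, (hpg k).2, (hpd k).le.trans (min_le_left _ _)⟩
    refine ⟨y, hy, fun z hz => ?_⟩
    rcases le_total (V (p k).1 z - φ z) (V (p k).1 y - φ y) with h | h
    · exact h
    · exact hy' hz h
  choose y hyg hymax using h2
  obtain ⟨y₀, hy₀, σ, hσ, hlim⟩ := ((isCompact_cube n).inter_right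
    (Metric.isClosed_closedBall (x := x) (ε := r))).tendsto_subseq
      (fun k => ⟨(hyg k).1.1, (hyg k).2⟩)
  have hσ' := hσ.tendsto_atTop
  have hinv : Tendsto (fun k => (1 : ℝ) / ((σ k : ℝ) + 1)) atTop (𝓝 0) :=
    tendsto_one_div_add_atTop_nhds_zero_nat.comp hσ'
  have hh0 : Tendsto (fun k => (p (σ k)).1) atTop (𝓝 0) :=
    squeeze_zero (fun k => (hpg _).1.le) (fun k => (hph _).le) hinv
  have hz : Tendsto (fun k => (p (σ k)).2) atTop (𝓝 x) :=
    tendsto_iff_dist_tendsto_zero.2 (squeeze_zero (fun k => dist_nonneg)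
      (fun k => (hpd _).le.trans (min_le_right _ _)) hinv)
  have hyt : Tendsto (fun k => ((p (σ k)).1, y (σ k))) atTop (gridNhds y₀) :=
    tendsto_gridNhds_iff.2 ⟨hh0, hlim, Eventually.of_forall fun k => ⟨(hpg _).1, (hyg _).1⟩⟩
  have hφz : Tendsto (fun k => φ (p (σ k)).2) atTop (𝓝 (φ x)) := (hφ.tendsto x).comp hz
  have hφy : Tendsto (fun k => φ (y (σ k))) atTop (𝓝 (φ y₀)) := (hφ.tendsto y₀).comp hlim
  have hlow : ∀ k, U x - 1 / ((σ k : ℝ) + 1) - φ (p (σ k)).2 + φ (y (σ k))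
      ≤ V (p (σ k)).1 (y (σ k)) := fun k => by
    have := hymax (σ k) (p (σ k)).2 ⟨(hpg _).2, (hpd _).le.trans (min_le_left _ _)⟩
    linarith [hpV (σ k)]
  have hlowt : Tendsto (fun k => U x - 1 / ((σ k : ℝ) + 1) - φ (p (σ k)).2 + φ (y (σ k))) atTop
      (𝓝 (U x - 0 - φ x + φ y₀)) := ((tendsto_const_nhds.sub hinv).sub hφz).add hφy
  have hge : U x - φ x ≤ U y₀ - φ y₀ := by
    refine le_of_forall_pos_le_add fun ε hε => ?_
    have := le_of_tendsto hlowt (b := U y₀ + ε) (by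
      filter_upwards [hyt.eventually (hup y₀ hy₀.1 (U y₀ + ε) (by linarith))] with k hk
      exact (hlow k).trans hk.le)
    linarith
  have hy₀x : y₀ = x := by
    by_contra hne
    exact absurd (hmax y₀ hy₀.1 hy₀.2 hne) (not_lt.2 hge)
  subst hy₀x
  refine ⟨fun k => (p (σ k)).1, fun k => y (σ k), hyt, ?_, fun k => ⟨(hpg _).1, (hyg _).1,
    fun z hz hzr => hymax _ z ⟨hz, hzr⟩⟩⟩
  refine tendsto_order.2 ⟨fun c hc => ?_, fun c hc => hyt.eventually (hup y₀ hx c hc)⟩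
  filter_upwards [hlowt.eventually (lt_mem_nhds (show c < U y₀ - 0 - φ y₀ + φ y₀ by linarith))]
    with k hk using hk.trans_le (hlow k)

theorem exists_seq_of_isLocalMaxOn (hx : x ∈ halfOpenCube n)
    (hup : ∀ y ∈ cube n, ∀ c, U y < c → ∀ᶠ p in gridNhds y, V p.1 p.2 < c)
    (hfreq : ∀ c, c < U x → ∃ᶠ p in gridNhds x, c < V p.1 p.2)
    (hφ : ContDiff ℝ 1 φ) (hmax : IsLocalMaxOn (fun y => U y - φ y) (halfOpenCube n) x) :
    ∃ (h : ℕ → ℝ) (y : ℕ → Fin n → ℝ) (D : Fin n → ℕ → ℝ),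
      (∀ᶠ k in atTop, 0 < h k ∧ y k ∈ halfOpenCube n ∩ lattice n (h k)) ∧
      Tendsto y atTop (𝓝 x) ∧ Tendsto (fun k => V (h k) (y k)) atTop (𝓝 (U x)) ∧
      (∀ i, Tendsto (D i) atTop (𝓝 (partialDeriv φ i x))) ∧
      ∀ᶠ k in atTop, ∀ i,
        D i k ≤ (V (h k) (y k) - V (h k) (y k - Pi.single i (h k))) / h k := by
  -- The quadratic term makes the maximum strict and leaves the gradient at `x` unchanged.
  set ψ : (Fin n → ℝ) → ℝ := fun y => φ y + 1 * ∑ j, (y j - x j) ^ 2 with hψdef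
  have hψ : ContDiff ℝ 1 ψ := hφ.add (contDiff_sq_dist 1 x)
  have hψi : ∀ i, partialDeriv ψ i x = partialDeriv φ i x := fun i => by
    rw [hψdef, partialDeriv_add hφ (contDiff_sq_dist 1 x), partialDeriv_sq_dist]
    simp
  have hev := (eventually_nhdsWithin_iff.1 hmax).and (eventually_mem_halfOpenCube hx)
  obtain ⟨r, hr, hball⟩ := Metric.nhds_basis_closedBall.eventually_iff.1 hev
  have hstrict : ∀ y ∈ cube n, dist y x ≤ r → y ≠ x → U y - ψ y < U x - ψ x := by
    intro y hy hyr hne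
    have h1 := (hball hyr).1 ((hball hyr).2 hy)
    obtain ⟨i, hi⟩ := Function.ne_iff.1 hne
    have h2 : 0 < ∑ j, (y j - x j) ^ 2 :=
      Finset.sum_pos' (fun j _ => sq_nonneg _)
        ⟨i, Finset.mem_univ i, by have := sub_ne_zero.2 hi; positivity⟩
    simp only [hψdef, sub_self, ne_eq, OfNat.ofNat_ne_zero, not_false_eq_true, zero_pow,
      Finset.sum_const_zero, mul_zero]
    linarith
  obtain ⟨h, y, ht, hV, hk⟩ := exists_seq_of_strict_max (halfOpenCube_subset_cube n hx) hup hfreq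
    hψ.continuous hr hstrict
  have hy := (tendsto_gridNhds_iff.1 ht).2.1
  have hh : Tendsto h atTop (𝓝[>] 0) := (tendsto_fst_gridNhds x).comp ht
  have hΩ : ∀ᶠ k in atTop, 0 < h k ∧ y k ∈ halfOpenCube n ∩ lattice n (h k) := by
    filter_upwards [hy.eventually (eventually_mem_halfOpenCube hx)] with k hk'
    exact ⟨(hk k).1, hk' (hk k).2.1.1, (hk k).2.1.2⟩
  refine ⟨h, y, fun i k => (ψ (y k) - ψ (y k - Pi.single i (h k))) / h k, hΩ, hy, hV,
    fun i => ?_, ?_⟩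
  · rw [← hψi]
    exact tendsto_backward_difference_quotient hψ hy hh i
  · refine eventually_all.2 fun i => ?_
    have hyi : Tendsto (fun k => y k - Pi.single i (h k)) atTop (𝓝 x) := by
      have h1 : Continuous fun t : ℝ => (Pi.single i t : Fin n → ℝ) :=
        continuous_single (A := fun _ : Fin n => ℝ) i
      have := hy.sub ((h1.tendsto 0).comp (hh.mono_right nhdsWithin_le_nhds))
      simpa using this
    filter_upwards [hΩ, hyi.eventually (Metric.closedBall_mem_nhds x hr)] with k hk1 hk2
    have h3 := (hk k).2.2 _ (sub_single_mem_grid hk1.1 hk1.2 i) hk2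
    exact div_le_div_of_nonneg_right (by linarith) hk1.1.le

end Touching

/-! ### Consistency of the scheme in the limit -/

section Limit

variable {n : ℕ} {f : (Fin n → ℝ) → ℝ} {V : ℝ → (Fin n → ℝ) → ℝ}

/-- The scheme is monotone in the quotients: at a grid maximum those of the test function are
bounded by those of `V`, whose product is given by the equation. -/
theorem hamP2_nonpos_of_upper_limit (hf : ContinuousOn f (cube n))
    (hV : ∀ h, 0 < h → IsMaximalSolutionS2 h f (V h)) {U : (Fin n → ℝ) → ℝ}
    (hup : ∀ y ∈ cube n, ∀ c, U y < c → ∀ᶠ p in gridNhds y, V p.1 p.2 < c)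
    {x : Fin n → ℝ} (hx : x ∈ halfOpenCube n)
    (hfreq : ∀ c, c < U x → ∃ᶠ p in gridNhds x, c < V p.1 p.2)
    {φ : (Fin n → ℝ) → ℝ} (hφ : ContDiff ℝ 1 φ)
    (hmax : IsLocalMaxOn (fun y => U y - φ y) (halfOpenCube n) x) :
    hamP2 f x (U x) (fun i => partialDeriv φ i x) ≤ 0 := by
  obtain ⟨h, y, D, hΩ, hy, hVy, hD, hle⟩ := exists_seq_of_isLocalMaxOn hx hup hfreq hφ hmax
  have hsub := halfOpenCube_subset_cube n
  have hfy : Tendsto (fun k => f (y k)) atTop (𝓝 (f x)) :=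
    (hf x (hsub hx)).tendsto.comp (tendsto_nhdsWithin_iff.2 ⟨hy, hΩ.mono fun k hk => hsub hk.2.1⟩)
  have hl : Tendsto (fun k => ∏ i, max (D i k) 0) atTop
      (𝓝 (∏ i, max (partialDeriv φ i x) 0)) :=
    tendsto_finsetProd _ fun i _ => (hD i).max tendsto_const_nhds
  refine sub_nonpos.2 (le_of_tendsto_of_tendsto hl ((hVy.pow (n - 1)).mul hfy) ?_)
  filter_upwards [hΩ, hle] with k hk hk'
  rw [← ((hV _ hk.1).2 _ hk.2).1]
  exact Finset.prod_le_prod (fun i _ => le_max_right _ _) fun i _ =>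
    max_le_max_right 0 (hk' i)

theorem hamP2_nonneg_of_lower_limit (hf : ContinuousOn f (cube n))
    (hV : ∀ h, 0 < h → IsMaximalSolutionS2 h f (V h)) {U : (Fin n → ℝ) → ℝ}
    (hlow : ∀ y ∈ cube n, ∀ c, c < U y → ∀ᶠ p in gridNhds y, c < V p.1 p.2)
    {x : Fin n → ℝ} (hx : x ∈ halfOpenCube n)
    (hfreq : ∀ c, U x < c → ∃ᶠ p in gridNhds x, V p.1 p.2 < c)
    {φ : (Fin n → ℝ) → ℝ} (hφ : ContDiff ℝ 1 φ)
    (hmin : IsLocalMinOn (fun y => U y - φ y) (halfOpenCube n) x) :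
    0 ≤ hamP2 f x (U x) (fun i => partialDeriv φ i x) := by
  obtain ⟨h, y, D, hΩ, hy, hVy, hD, hle⟩ := exists_seq_of_isLocalMaxOn
    (V := fun h y => -V h y) (U := fun y => -U y) (φ := fun y => -φ y) hx
    (fun y hy c hc => (hlow y hy (-c) (by linarith)).mono fun p hp => by linarith)
    (fun c hc => (hfreq (-c) (by linarith)).mono fun p hp => by linarith) hφ.neg (by
      filter_upwards [hmin] with y hy
      linarith)
  have hsub := halfOpenCube_subset_cube n
  have hVy' : Tendsto (fun k => V (h k) (y k)) atTop (𝓝 (U x)) := by simpa using hVy.neg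
  have hfy : Tendsto (fun k => f (y k)) atTop (𝓝 (f x)) :=
    (hf x (hsub hx)).tendsto.comp (tendsto_nhdsWithin_iff.2 ⟨hy, hΩ.mono fun k hk => hsub hk.2.1⟩)
  have hl : Tendsto (fun k => ∏ i, max (-D i k) 0) atTop
      (𝓝 (∏ i, max (partialDeriv φ i x) 0)) :=
    tendsto_finsetProd _ fun i _ => by
      have := (hD i).neg
      rw [partialDeriv_neg, neg_neg] at this
      exact this.max tendsto_const_nhds
  refine sub_nonneg.2 (le_of_tendsto_of_tendsto ((hVy'.pow (n - 1)).mul hfy) hl ?_)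
  filter_upwards [hΩ, hle] with k hk hk'
  rw [← ((hV _ hk.1).2 _ hk.2).1]
  refine Finset.prod_le_prod (fun i _ => le_max_right _ _) fun i _ => max_le_max_right 0 ?_
  have h1 := hk' i
  rw [← neg_le_neg_iff, ← neg_div] at h1
  refine le_trans (le_of_eq ?_) h1
  congr 1
  ring

end Limit

section Congr

variable {n : ℕ} {H : (Fin n → ℝ) → ℝ → (Fin n → ℝ) → ℝ} {u v : (Fin n → ℝ) → ℝ}

theorem IsViscositySubsolution.congr (hu : IsViscositySubsolution H u)
    (h : Set.EqOn u v (cube n)) : IsViscositySubsolution H v := by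
  obtain ⟨h1, h2, h3⟩ := hu
  have hsub := halfOpenCube_subset_cube n
  refine ⟨fun x hx c hc => ?_, fun x hx => h (Gam_subset_cube n hx) ▸ h2 x hx,
    fun x hx φ hφ hmax => ?_⟩
  · filter_upwards [h1 x hx c (by simpa only [h hx] using hc), self_mem_nhdsWithin] with y hy hyc
    rwa [← h hyc]
  · rw [← h (hsub hx)]
    refine h3 x hx φ hφ ?_
    filter_upwards [hmax, self_mem_nhdsWithin] with y hy hyΩ
    rwa [h (hsub hx), h (hsub hyΩ)]

theorem IsViscositySupersolution.congr (hu : IsViscositySupersolution H u)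
    (h : Set.EqOn u v (cube n)) : IsViscositySupersolution H v := by
  obtain ⟨h1, h2, h3⟩ := hu
  have hsub := halfOpenCube_subset_cube n
  refine ⟨fun x hx c hc => ?_, fun x hx => h (Gam_subset_cube n hx) ▸ h2 x hx,
    fun x hx φ hφ hmin => ?_⟩
  · filter_upwards [h1 x hx c (by simpa only [h hx] using hc), self_mem_nhdsWithin] with y hy hyc
    rwa [← h hyc]
  · rw [← h (hsub hx)]
    refine h3 x hx φ hφ ?_
    filter_upwards [hmin, self_mem_nhdsWithin] with y hy hyΩ
    rwa [h (hsub hx), h (hsub hyΩ)]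

end Congr

/-! ### The inverse substitution -/

/-- The change of variables `s ↦ n s^{1/n}` that turns (P2) into (P1). -/
noncomputable def scaledRoot (n : ℕ) (s : ℝ) : ℝ := n * max s 0 ^ (n⁻¹ : ℝ)

section ScaledRoot

variable {n : ℕ}

theorem continuous_scaledRoot (n : ℕ) : Continuous (scaledRoot n) :=
  continuous_const.mul ((continuous_id.max continuous_const).rpow_const
    fun _ => Or.inr (by positivity))

theorem monotone_scaledRoot (n : ℕ) : Monotone (scaledRoot n) := fun a b hab =>
  mul_le_mul_of_nonneg_left (Real.rpow_le_rpow (le_max_right _ _) (max_le_max_right 0 hab)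
    (by positivity)) (Nat.cast_nonneg n)

theorem scaledRoot_nonneg (n : ℕ) (s : ℝ) : 0 ≤ scaledRoot n s := by
  unfold scaledRoot
  positivity

theorem scaledRoot_div_pow (hn : 1 ≤ n) {s : ℝ} (hs : 0 ≤ s) : (scaledRoot n s / n) ^ n = s := by
  have hn0 : n ≠ 0 := by omega
  have hn' : (n : ℝ) ≠ 0 := by exact_mod_cast hn0
  rw [scaledRoot, mul_div_cancel_left₀ _ hn', Real.rpow_inv_natCast_pow (le_max_right _ _) hn0,
    max_eq_left hs]

theorem scaledRoot_pos (hn : 1 ≤ n) {s : ℝ} (hs : 0 < s) : 0 < scaledRoot n s := by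
  have hn' : (0 : ℝ) < n := by exact_mod_cast hn
  exact mul_pos hn' (Real.rpow_pos_of_pos (lt_max_of_lt_left hs) _)

theorem le_of_scaledRoot_le (hn : 1 ≤ n) {s t : ℝ} (hs : 0 ≤ s) (ht : 0 ≤ t)
    (h : scaledRoot n s ≤ scaledRoot n t) : s ≤ t := by
  rw [← scaledRoot_div_pow hn hs, ← scaledRoot_div_pow hn ht]
  have := scaledRoot_nonneg n s
  gcongr

theorem isViscositySubsolution_scaledRoot (hn : 1 ≤ n) {f w : (Fin n → ℝ) → ℝ}
    (hf0 : ∀ x ∈ cube n, 0 ≤ f x) (hw : IsViscositySubsolution (hamP2 f) w)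
    (hw0 : ∀ x ∈ cube n, 0 ≤ w x) :
    IsViscositySubsolution (hamP1 f) fun x => scaledRoot n (w x) :=
  subsolution_of_pow hn hf0 hw (fun _ _ => scaledRoot_nonneg n _)
    (fun x hx => (scaledRoot_div_pow hn (hw0 x hx)).symm)
    ((continuous_scaledRoot n).comp_upperSemicontinuousOn hw.1 (monotone_scaledRoot n))

theorem isViscositySupersolution_scaledRoot (hn : 1 ≤ n) {f w : (Fin n → ℝ) → ℝ}
    (hf0 : ∀ x ∈ cube n, 0 ≤ f x) (hw : IsViscositySupersolution (hamP2 f) w)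
    (hw0 : ∀ x ∈ cube n, 0 ≤ w x) (hpos : ∀ x ∈ halfOpenCube n, 0 < f x → 0 < w x) :
    IsViscositySupersolution (hamP1 f) fun x => scaledRoot n (w x) :=
  supersolution_of_pow hn hf0 hw (fun _ _ => scaledRoot_nonneg n _)
    (fun x hx => (scaledRoot_div_pow hn (hw0 x hx)).symm)
    (fun x hx hfx => scaledRoot_pos hn (hpos x hx hfx))
    ((continuous_scaledRoot n).comp_lowerSemicontinuousOn hw.1 (monotone_scaledRoot n))

end ScaledRoot

/-! ### Half-relaxed limits and convergence -/

section RelaxedLimits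

variable {n : ℕ} {f : (Fin n → ℝ) → ℝ} {V : ℝ → (Fin n → ℝ) → ℝ}

/-- The upper half-relaxed limit of a family of grid functions as the mesh size tends to `0`. -/
noncomputable def upperLimit (V : ℝ → (Fin n → ℝ) → ℝ) (x : Fin n → ℝ) : ℝ :=
  limsup (fun p : ℝ × (Fin n → ℝ) => V p.1 p.2) (gridNhds x)

/-- The lower half-relaxed limit of a family of grid functions as the mesh size tends to `0`. -/
noncomputable def lowerLimit (V : ℝ → (Fin n → ℝ) → ℝ) (x : Fin n → ℝ) : ℝ :=
  liminf (fun p : ℝ × (Fin n → ℝ) => V p.1 p.2) (gridNhds x)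

section Bounded

variable {a b : ℝ} (hab : ∀ h, 0 < h → ∀ x ∈ cube n ∩ lattice n h, V h x ∈ Set.Icc a b)
include hab

theorem isBoundedUnder_le_gridNhds (x : Fin n → ℝ) :
    (gridNhds x).IsBoundedUnder (· ≤ ·) fun p => V p.1 p.2 :=
  isBoundedUnder_of_eventually_le
    ((eventually_mem_gridNhds x).mono fun p hp => (hab p.1 hp.1 p.2 hp.2).2)

theorem isBoundedUnder_ge_gridNhds (x : Fin n → ℝ) :
    (gridNhds x).IsBoundedUnder (· ≥ ·) fun p => V p.1 p.2 :=
  isBoundedUnder_of_eventually_ge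
    ((eventually_mem_gridNhds x).mono fun p hp => (hab p.1 hp.1 p.2 hp.2).1)

theorem eventually_lt_of_upperLimit_lt {x : Fin n → ℝ} {c : ℝ} (hc : upperLimit V x < c) :
    ∀ᶠ p in gridNhds x, V p.1 p.2 < c :=
  eventually_lt_of_limsup_lt hc (isBoundedUnder_le_gridNhds hab x)

theorem eventually_lt_of_lt_lowerLimit {x : Fin n → ℝ} {c : ℝ} (hc : c < lowerLimit V x) :
    ∀ᶠ p in gridNhds x, c < V p.1 p.2 :=
  eventually_lt_of_lt_liminf hc (isBoundedUnder_ge_gridNhds hab x)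

theorem upperLimit_le {x : Fin n → ℝ} (hx : x ∈ cube n) {c : ℝ}
    (hc : ∀ᶠ p in gridNhds x, V p.1 p.2 ≤ c) : upperLimit V x ≤ c :=
  have := gridNhds_neBot hx
  limsup_le_of_le (isBoundedUnder_ge_gridNhds hab x).isCoboundedUnder_flip hc

theorem le_lowerLimit {x : Fin n → ℝ} (hx : x ∈ cube n) {c : ℝ}
    (hc : ∀ᶠ p in gridNhds x, c ≤ V p.1 p.2) : c ≤ lowerLimit V x :=
  have := gridNhds_neBot hx
  le_liminf_of_le (isBoundedUnder_le_gridNhds hab x).isCoboundedUnder_flip hc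

theorem frequently_lt_of_lt_upperLimit {x : Fin n → ℝ} (hx : x ∈ cube n) {c : ℝ}
    (hc : c < upperLimit V x) : ∃ᶠ p in gridNhds x, c < V p.1 p.2 := fun hcon =>
  hc.not_ge (upperLimit_le hab hx (hcon.mono fun _ hp => not_lt.1 hp))

theorem frequently_lt_of_lowerLimit_lt {x : Fin n → ℝ} (hx : x ∈ cube n) {c : ℝ}
    (hc : lowerLimit V x < c) : ∃ᶠ p in gridNhds x, V p.1 p.2 < c := fun hcon =>
  hc.not_ge (le_lowerLimit hab hx (hcon.mono fun _ hp => not_lt.1 hp))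

theorem lowerLimit_le_upperLimit {x : Fin n → ℝ} (hx : x ∈ cube n) :
    lowerLimit V x ≤ upperLimit V x :=
  have := gridNhds_neBot hx
  liminf_le_limsup (isBoundedUnder_le_gridNhds hab x) (isBoundedUnder_ge_gridNhds hab x)

theorem upperSemicontinuousOn_upperLimit : UpperSemicontinuousOn (upperLimit V) (cube n) := by
  intro x _ c hc
  obtain ⟨d, hd, hdc⟩ := exists_between hc
  have := (eventually_eventually_gridNhds (eventually_lt_of_upperLimit_lt hab hd)).filter_mono
    (nhdsWithin_le_nhds (s := cube n))
  filter_upwards [this, self_mem_nhdsWithin] with y hy hyc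
  exact (upperLimit_le hab hyc (hy.mono fun _ h => h.le)).trans_lt hdc

theorem lowerSemicontinuousOn_lowerLimit : LowerSemicontinuousOn (lowerLimit V) (cube n) := by
  intro x _ c hc
  obtain ⟨d, hcd, hd⟩ := exists_between hc
  have := (eventually_eventually_gridNhds (eventually_lt_of_lt_lowerLimit hab hd)).filter_mono
    (nhdsWithin_le_nhds (s := cube n))
  filter_upwards [this, self_mem_nhdsWithin] with y hy hyc
  exact hcd.trans_le (le_lowerLimit hab hyc (hy.mono fun _ h => h.le))

theorem monotoneOn_lowerLimit
    (hmono : ∀ h, 0 < h → MonotoneOn (V h) (cube n ∩ lattice n h)) :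
    MonotoneOn (lowerLimit V) (cube n) := by
  intro x hx y hy hxy
  refine le_of_forall_lt fun c hc => ?_
  obtain ⟨d, hcd, hd⟩ := exists_between hc
  refine hcd.trans_le (le_lowerLimit hab hy ?_)
  filter_upwards [(tendsto_inf_gridFloor hx hxy).eventually
    (eventually_lt_of_lt_lowerLimit hab hd), eventually_mem_gridNhds y] with p hp hpg
  exact hp.le.trans (hmono p.1 hpg.1 (inf_mem_grid hpg.2 (gridFloor_mem hx hpg.1)) hpg.2
    inf_le_left)

/-- Equality of the limits makes `v` both upper and lower semicontinuous and controls `V` on grids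
near each point; compactness of the cube yields one `δ`. -/
theorem tendstoUniformly_of_upperLimit_eq_lowerLimit {v : (Fin n → ℝ) → ℝ}
    (hup : ∀ x ∈ cube n, upperLimit V x = v x) (hlow : ∀ x ∈ cube n, lowerLimit V x = v x)
    {ε : ℝ} (hε : 0 < ε) :
    ∃ δ : ℝ, 0 < δ ∧ ∀ h : ℝ, 0 < h → h < δ → ∀ x ∈ cube n ∩ lattice n h, |V h x - v x| < ε := by
  have hloc : ∀ y ∈ cube n, ∀ᶠ p in 𝓝 ((0 : ℝ), y),
      0 < p.1 ∧ p.2 ∈ cube n ∩ lattice n p.1 → |V p.1 p.2 - v p.2| < ε := by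
    intro y hy
    rw [← eventually_gridNhds]
    have ht : Tendsto Prod.snd (gridNhds y) (𝓝[cube n] y) :=
      tendsto_nhdsWithin_iff.2 ⟨tendsto_snd_gridNhds y,
        (eventually_mem_gridNhds y).mono fun p hp => hp.2.1⟩
    have h1 := eventually_lt_of_upperLimit_lt hab
      (show upperLimit V y < v y + ε / 2 by rw [hup y hy]; linarith)
    have h2 := eventually_lt_of_lt_lowerLimit hab
      (show v y - ε / 2 < lowerLimit V y by rw [hlow y hy]; linarith)
    have h3 := ht.eventually (upperSemicontinuousOn_upperLimit hab y hy (v y + ε / 2)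
      (by simp only [hup y hy]; linarith))
    have h4 := ht.eventually (lowerSemicontinuousOn_lowerLimit hab y hy (v y - ε / 2)
      (by simp only [hlow y hy]; linarith))
    filter_upwards [h1, h2, h3, h4, eventually_mem_gridNhds y] with p p1 p2 p3 p4 p5
    rw [hup _ p5.2.1] at p3
    rw [hlow _ p5.2.1] at p4
    rw [abs_lt]
    constructor <;> linarith
  have := (isCompact_cube n).eventually_forall_of_forall_eventually
    (P := fun h z => 0 < h ∧ z ∈ cube n ∩ lattice n h → |V h z - v z| < ε) hloc
  obtain ⟨δ, hδ, hb⟩ := Metric.eventually_nhds_iff.1 this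
  refine ⟨δ, hδ, fun h hh hhδ x hx => hb (y := h) ?_ x hx.1 ⟨hh, hx⟩⟩
  rwa [Real.dist_eq, sub_zero, abs_of_pos hh]

end Bounded

/-- The lower barrier on the box `x ± δ`, where `f ≥ f x / 2`, is at least `f x / 2 * (δ/2)^n` at
grid points within `δ/2` of `x`. -/
theorem lowerLimit_pos (hn : 1 ≤ n) (hf : ContinuousOn f (cube n)) (hf0 : ∀ x ∈ cube n, 0 ≤ f x)
    (hV : ∀ h, 0 < h → IsMaximalSolutionS2 h f (V h)) {a b : ℝ}
    (hab : ∀ h, 0 < h → ∀ x ∈ cube n ∩ lattice n h, V h x ∈ Set.Icc a b)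
    {x : Fin n → ℝ} (hx : x ∈ halfOpenCube n) (hfx : 0 < f x) : 0 < lowerLimit V x := by
  have hxc := halfOpenCube_subset_cube n hx
  have h1 : ∀ᶠ y in 𝓝 x, y ∈ cube n → f x / 2 < f y :=
    eventually_nhdsWithin_iff.1 ((hf x hxc).eventually (lt_mem_nhds (half_lt_self hfx)))
  have h2 : ∀ᶠ y in 𝓝 x, ∀ i, 0 < y i :=
    eventually_all.2 fun i => (continuous_apply i).continuousAt.eventually (lt_mem_nhds (hx i).1)
  obtain ⟨δ, hδ, hball⟩ := Metric.nhds_basis_closedBall.eventually_iff.1 (h1.and h2)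
  have hmem : ∀ y : Fin n → ℝ, (∀ i, x i - δ ≤ y i) → (∀ i, y i ≤ x i + δ) →
      y ∈ Metric.closedBall x δ := fun y hy1 hy2 => by
    rw [Metric.mem_closedBall, dist_pi_le_iff hδ.le]
    intro i
    rw [Real.dist_eq, abs_le]
    constructor <;> linarith [hy1 i, hy2 i]
  have ha : ∀ i, 0 ≤ x i - δ := fun i =>
    ((hball (hmem (fun i => x i - δ) (fun _ => le_rfl) fun i => by linarith)).2 i).le
  have hpos : 0 < f x / 2 * (δ / 2) ^ n := by positivity
  refine hpos.trans_le (le_lowerLimit hab hxc ?_)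
  filter_upwards [eventually_mem_gridNhds x, (tendsto_snd_gridNhds x).eventually
    (Metric.closedBall_mem_nhds x (half_pos hδ))] with p hp hpx
  rw [dist_pi_le_iff (half_pos hδ).le] at hpx
  have hpi : ∀ i, x i - δ / 2 ≤ p.2 i ∧ p.2 i ≤ x i + δ / 2 := fun i => by
    have := hpx i
    rw [Real.dist_eq, abs_le] at this
    constructor <;> linarith [this.1, this.2]
  have h3 := (hV p.1 hp.1).mul_prod_le hn hp.1 hf0 (half_pos hfx).le (a := fun i => x i - δ)
    (b := fun i => x i + δ) ha (fun y hy hy1 hy2 => ((hball (hmem y hy1 hy2)).1 hy).le) p.2 hp.2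
    fun i => by linarith [(hpi i).2]
  refine le_trans (mul_le_mul_of_nonneg_left ?_ (half_pos hfx).le) h3
  have := Finset.prod_le_prod (s := (Finset.univ : Finset (Fin n))) (f := fun _ => δ / 2)
    (g := fun i => max (p.2 i - (x i - δ)) 0) (fun i _ => (half_pos hδ).le)
    fun i _ => le_max_of_le_left (by linarith [(hpi i).1])
  rwa [Finset.prod_const, Finset.card_univ, Fintype.card_fin] at this

theorem exists_solution_tendsto (hn : 1 ≤ n) (hf : ContinuousOn f (cube n))
    (hf0 : ∀ x ∈ cube n, 0 ≤ f x) (hV : ∀ h, 0 < h → IsMaximalSolutionS2 h f (V h)) :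
    ∃ u : (Fin n → ℝ) → ℝ, IsNondecreasingSolutionP1 f u ∧ (∀ x ∈ cube n, 0 ≤ u x) ∧
      IsViscositySolution (hamP2 f) (fun x => u x ^ n / (n : ℝ) ^ n) ∧
      ∀ ε : ℝ, 0 < ε → ∃ δ : ℝ, 0 < δ ∧ ∀ h : ℝ, 0 < h → h < δ →
        ∀ x ∈ cube n ∩ lattice n h, |V h x - u x ^ n / (n : ℝ) ^ n| < ε := by
  obtain ⟨C, hC, hfC⟩ : ∃ C, 0 < C ∧ ∀ x ∈ cube n, f x ≤ C := by
    obtain ⟨C, hC⟩ := (isCompact_cube n).bddAbove_image hf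
    exact ⟨max C 1, by positivity, fun x hx => le_max_of_le_left (hC ⟨x, hx, rfl⟩)⟩
  have hle : ∀ h, 0 < h → ∀ x ∈ cube n ∩ lattice n h, V h x ≤ C * ∏ i, x i := fun h hh =>
    (hV h hh).le_mul_prod hn hh hC hfC
  have hab : ∀ h, 0 < h → ∀ x ∈ cube n ∩ lattice n h, V h x ∈ Set.Icc 0 C := fun h hh x hx =>
    ⟨(hV h hh).nonneg hn hh hf0 x hx, (hle h hh x hx).trans (mul_le_of_le_one_right hC.le
      (Finset.prod_le_one (fun i _ => (hx.1 i).1) fun i _ => (hx.1 i).2))⟩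
  have hsub := halfOpenCube_subset_cube n
  have hL0 : ∀ x ∈ cube n, 0 ≤ lowerLimit V x := fun x hx =>
    le_lowerLimit hab hx ((eventually_mem_gridNhds x).mono fun p hp => (hab _ hp.1 _ hp.2).1)
  have hLU : ∀ x ∈ cube n, lowerLimit V x ≤ upperLimit V x := fun x hx =>
    lowerLimit_le_upperLimit hab hx
  have hU0 : ∀ x ∈ cube n, 0 ≤ upperLimit V x := fun x hx => (hL0 x hx).trans (hLU x hx)
  have hUΓ : ∀ x ∈ Gam n, upperLimit V x ≤ 0 := by
    intro x hx
    obtain ⟨hxc, i, hi⟩ := mem_Gam_iff.1 hx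
    have hcont : Continuous fun y : Fin n → ℝ => C * ∏ i, y i := by fun_prop
    have ht := (hcont.tendsto x).comp (tendsto_snd_gridNhds x)
    rw [Finset.prod_eq_zero (Finset.mem_univ i) hi, mul_zero] at ht
    refine le_of_forall_pos_le_add fun ε hε => upperLimit_le hab hxc ?_
    filter_upwards [ht.eventually (gt_mem_nhds hε), eventually_mem_gridNhds x] with p hp hpg
    exact ((hle _ hpg.1 _ hpg.2).trans hp.le).trans (zero_add ε).ge
  have hUsub : IsViscositySubsolution (hamP2 f) (upperLimit V) :=
    ⟨upperSemicontinuousOn_upperLimit hab, hUΓ, fun x hx φ hφ hmax =>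
      hamP2_nonpos_of_upper_limit hf hV (fun y _ c hc => eventually_lt_of_upperLimit_lt hab hc) hx
        (fun c hc => frequently_lt_of_lt_upperLimit hab (hsub hx) hc) hφ hmax⟩
  have hLsup : IsViscositySupersolution (hamP2 f) (lowerLimit V) :=
    ⟨lowerSemicontinuousOn_lowerLimit hab, fun x hx => hL0 x (Gam_subset_cube n hx),
      fun x hx φ hφ hmin => hamP2_nonneg_of_lower_limit hf hV
        (fun y _ c hc => eventually_lt_of_lt_lowerLimit hab hc) hx
        (fun c hc => frequently_lt_of_lowerLimit_lt hab (hsub hx) hc) hφ hmin⟩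
  have hLmono := monotoneOn_lowerLimit hab fun h hh => (hV h hh).monotoneOn hn hh hf0
  have hsub1 := isViscositySubsolution_scaledRoot hn hf0 hUsub hU0
  have hsup1 := isViscositySupersolution_scaledRoot hn hf0 hLsup hL0
    fun x hx hfx => lowerLimit_pos hn hf hf0 hV hab hx hfx
  have hmono1 : MonotoneOn (fun x => scaledRoot n (lowerLimit V x)) (cube n) :=
    (monotone_scaledRoot n).comp_monotoneOn hLmono
  -- Comparison gives the nontrivial inequality; it applies because the lower limit is nondecreasing
  -- and positive where `f > 0`.
  have hUL : Set.EqOn (upperLimit V) (lowerLimit V) (cube n) := fun x hx =>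
    le_antisymm (le_of_scaledRoot_le hn (hU0 x hx) (hL0 x hx)
      (comparison hn hf hsub1 hsup1 hmono1 x hx)) (hLU x hx)
  have hpow : ∀ x ∈ cube n, lowerLimit V x
      = scaledRoot n (lowerLimit V x) ^ n / (n : ℝ) ^ n := fun x hx => by
    rw [← div_pow, scaledRoot_div_pow hn (hL0 x hx)]
  refine ⟨fun x => scaledRoot n (lowerLimit V x), ⟨hmono1, hsub1.congr fun x hx => ?_, hsup1⟩,
    fun x _ => scaledRoot_nonneg n _, ⟨hUsub.congr fun x hx => ?_, hLsup.congr hpow⟩,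
    fun ε hε => tendstoUniformly_of_upperLimit_eq_lowerLimit hab (fun x hx => ?_)
      (fun x hx => hpow x hx) hε⟩
  · simp only [hUL hx]
  · rw [hUL hx]
    exact hpow x hx
  · rw [hUL hx]
    exact hpow x hx

end RelaxedLimits

/-! ### Uniqueness for (P1) and failure of comparison for (P2) -/

section Uniqueness

variable {n : ℕ} {f : (Fin n → ℝ) → ℝ}

theorem IsNondecreasingSolutionP1.eqOn (hn : 1 ≤ n) (hf : ContinuousOn f (cube n))
    {u v : (Fin n → ℝ) → ℝ} (hu : IsNondecreasingSolutionP1 f u)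
    (hv : IsNondecreasingSolutionP1 f v) : Set.EqOn u v (cube n) := fun x hx =>
  le_antisymm (comparison hn hf hu.2.1 hv.2.2 hv.1 x hx)
    (comparison hn hf hv.2.1 hu.2.2 hu.1 x hx)

theorem isViscositySolution_zero (hn : 2 ≤ n) :
    IsViscositySolution (hamP2 f) fun _ : Fin n → ℝ => 0 := by
  have hz : ∀ x : Fin n → ℝ, (0 : ℝ) ^ (n - 1) * f x = 0 := fun x => by
    rw [zero_pow (by omega), zero_mul]
  refine ⟨⟨continuousOn_const.upperSemicontinuousOn, fun _ _ => le_rfl,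
      fun x hx φ hφ hmax => ?_⟩, continuousOn_const.lowerSemicontinuousOn, fun _ _ => le_rfl,
      fun x _ φ _ _ => ?_⟩
  · have h1 : 0 ≤ partialDeriv (fun y => -φ y) ⟨0, by omega⟩ x := by
      refine partialDeriv_nonneg_of_eventually_le hφ.neg hx ?_ _
      filter_upwards [hmax] with y hy _
      linarith
    rw [partialDeriv_neg] at h1
    rw [hamP2, hz, sub_zero, Finset.prod_eq_zero (Finset.mem_univ (⟨0, by omega⟩ : Fin n))
      (max_eq_right (by linarith))]
  · rw [hamP2, hz, sub_zero]
    exact Finset.prod_nonneg fun i _ => le_max_right _ _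

theorem exists_pos_of_supersolution (hn : 1 ≤ n) (hf : ContinuousOn f (cube n))
    (hf0 : ∀ x ∈ cube n, 0 ≤ f x) (hfne : ∃ x ∈ cube n, f x ≠ 0) {u : (Fin n → ℝ) → ℝ}
    (hu : IsViscositySupersolution (hamP1 f) u) (hu0 : ∀ x ∈ cube n, 0 ≤ u x) :
    ∃ x ∈ cube n, 0 < u x := by
  by_contra! hcon
  have hzero : ∀ x ∈ cube n, u x = 0 := fun x hx => le_antisymm (hcon x hx) (hu0 x hx)
  obtain ⟨x, hx, hfx⟩ := hfne
  have hfpos : 0 < f x := lt_of_le_of_ne (hf0 x hx) (Ne.symm hfx)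
  -- The point `x` may lie on Γ, where no viscosity inequality holds. Raising its coordinates to at
  -- least a small `t` brings it into the half-open cube with `f` still positive; there a constant
  -- touches `u = 0` from below.
  have hmem : ∀ᶠ t in 𝓝[>] (0 : ℝ), (fun i => max (x i) t) ∈ halfOpenCube n := by
    filter_upwards [Ioo_mem_nhdsGT (zero_lt_one' ℝ)] with t ht i
    exact ⟨lt_max_of_lt_right ht.1, max_le (hx i).2 ht.2.le⟩
  have hlim : Tendsto (fun t : ℝ => fun i => max (x i) t) (𝓝[>] 0) (𝓝[cube n] x) := by
    refine tendsto_nhdsWithin_iff.2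
      ⟨?_, hmem.mono fun t ht => halfOpenCube_subset_cube n ht⟩
    have hcont : Continuous fun t : ℝ => fun i => max (x i) t := by fun_prop
    have := (hcont.tendsto 0).mono_left (nhdsWithin_le_nhds (s := Set.Ioi 0))
    simpa only [max_eq_left (hx _).1] using this
  obtain ⟨t, ht, hft⟩ := (hmem.and
    (((hf x hx).tendsto.comp hlim).eventually (lt_mem_nhds hfpos))).exists
  have h1 := hu.2.2 _ ht (fun _ => 0) contDiff_const (by
    filter_upwards [self_mem_nhdsWithin] with y hy
    rw [hzero _ (halfOpenCube_subset_cube n hy), hzero _ (halfOpenCube_subset_cube n ht)])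
  have h2 : ∏ i : Fin n, max (partialDeriv (fun _ : Fin n → ℝ => (0 : ℝ)) i
      fun i => max (x i) t) 0 = 0 :=
    Finset.prod_eq_zero (Finset.mem_univ (⟨0, hn⟩ : Fin n)) (by simp [partialDeriv])
  simp only [hamP1, h2, zero_sub] at h1
  simp only [Function.comp] at hft
  linarith

end Uniqueness

theorem mainTheorem4 (n : ℕ) (hn : 1 ≤ n) (f : (Fin n → ℝ) → ℝ)
    (hf : ContinuousOn f (cube n)) (hf0 : ∀ x ∈ cube n, 0 ≤ f x) :
    -- (P1) has exactly one nondecreasing viscosity solution on `[0,1]^n`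
    (∃ u : (Fin n → ℝ) → ℝ, IsNondecreasingSolutionP1 f u ∧
      ∀ u' : (Fin n → ℝ) → ℝ, IsNondecreasingSolutionP1 f u' → Set.EqOn u' u (cube n)) ∧
    -- `v = u^n / n^n` is a viscosity solution of (P2) that lies above every nonnegative subsolution
    (∀ v : (Fin n → ℝ) → ℝ, IsMaximalSolutionP2 f v →
      IsViscositySolution (hamP2 f) v ∧
      ∀ w : (Fin n → ℝ) → ℝ, IsViscositySubsolution (hamP2 f) w → (∀ x ∈ cube n, 0 ≤ w x) →
        ∀ x ∈ cube n, w x ≤ v x) ∧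
    -- for each mesh size the scheme (S2) has exactly one maximal solution on the grid
    (∀ h : ℝ, 0 < h → ∃ vh : (Fin n → ℝ) → ℝ, IsMaximalSolutionS2 h f vh ∧
      ∀ vh' : (Fin n → ℝ) → ℝ, IsMaximalSolutionS2 h f vh' →
        Set.EqOn vh' vh (cube n ∩ lattice n h)) ∧
    -- uniform convergence of the maximal solutions of (S2)
    (∀ (v : (Fin n → ℝ) → ℝ) (vh : ℝ → (Fin n → ℝ) → ℝ),
      IsMaximalSolutionP2 f v → (∀ h : ℝ, 0 < h → IsMaximalSolutionS2 h f (vh h)) →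
        ∀ ε : ℝ, 0 < ε → ∃ δ : ℝ, 0 < δ ∧ ∀ h : ℝ, 0 < h → h < δ →
          ∀ x ∈ cube n ∩ lattice n h, |vh h x - v x| < ε) ∧
    -- failure of the comparison principle for (P2)
    (2 ≤ n → (∃ x ∈ cube n, f x ≠ 0) →
      ∃ w₁ w₂ : (Fin n → ℝ) → ℝ,
        IsViscositySolution (hamP2 f) w₁ ∧ IsViscositySolution (hamP2 f) w₂ ∧
        MonotoneOn w₁ (cube n) ∧ MonotoneOn w₂ (cube n) ∧
        (∀ x ∈ cube n, 0 ≤ w₁ x) ∧ (∀ x ∈ cube n, 0 ≤ w₂ x) ∧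
        ∃ x ∈ cube n, w₂ x < w₁ x) := by
  have hS2 : ∀ h : ℝ, ∃ V, 0 < h → IsMaximalSolutionS2 h f V := fun h => by
    by_cases hh : 0 < h
    · obtain ⟨V, hV⟩ := exists_isMaximalSolutionS2 hn hh hf0
      exact ⟨V, fun _ => hV⟩
    · exact ⟨0, fun h => absurd h hh⟩
  choose V hV using hS2
  obtain ⟨u, hu, hu0, huP2, hconv⟩ := exists_solution_tendsto hn hf hf0 hV
  have hvu : ∀ v, IsMaximalSolutionP2 f v →
      Set.EqOn (fun x => u x ^ n / (n : ℝ) ^ n) v (cube n) := by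
    rintro v ⟨u', hu', hv⟩ x hx
    simp only [hv x hx, hu'.eqOn hn hf hu hx]
  have hnpos : (0 : ℝ) < n := by exact_mod_cast hn
  refine ⟨⟨u, hu, fun u' hu' => hu'.eqOn hn hf hu⟩, fun v hv => ?_, fun h hh => ?_,
    fun v vh hv hvh ε hε => ?_, fun hn2 hfne => ?_⟩
  · refine ⟨⟨huP2.1.congr (hvu v hv), huP2.2.congr (hvu v hv)⟩, fun w hw hw0 x hx => ?_⟩
    have h1 := comparison hn hf (isViscositySubsolution_scaledRoot hn hf0 hw hw0) hu.2.2 hu.1 x hx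
    have h2 := scaledRoot_nonneg n (w x)
    rw [← hvu v hv hx, ← scaledRoot_div_pow hn (hw0 x hx), div_pow]
    dsimp only
    gcongr
  · exact ⟨V h, hV h hh, fun vh' hvh' => (hV h hh).eqOn hh hvh'⟩
  · obtain ⟨δ, hδ, hδ'⟩ := hconv ε hε
    refine ⟨δ, hδ, fun h hh hhδ x hx => ?_⟩
    rw [(hV h hh).eqOn hh (hvh h hh) hx, ← hvu v hv hx.1]
    exact hδ' h hh hhδ x hx
  · obtain ⟨x, hx, hux⟩ := exists_pos_of_supersolution hn hf hf0 hfne hu.2.2 hu0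
    -- The maximal solution is positive somewhere, so it is not below the zero solution.
    refine ⟨fun x => u x ^ n / (n : ℝ) ^ n, fun _ => 0, huP2, isViscositySolution_zero hn2,
      fun y hy z hz hyz => ?_, monotoneOn_const, fun y hy => ?_, fun _ _ => le_rfl, x, hx, ?_⟩
    · have h1 := hu.1 hy hz hyz
      have h2 := hu0 y hy
      dsimp only
      gcongr
    · have := hu0 y hy
      positivity
    · positivity
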